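/- Let $v_1=(0,0)$, $v_2=(1/2,\sqrt3/2)$, $v_3=(1,0)$, $F_i(x)=\tfrac12(x-v_i)+v_i$, and let $K\subset\mathbb R^2$ be the Sierpinski gasket, i.e. the unique nonempty compact set with $K=\bigcup_{i=1}^3F_i(K)$. For a word $w=(w_1,\dots,w_n)\in\{1,2,3\}^n$ put $F_w=F_{w_1}\circ\dots\circ F_{w_n}$. Let $V_0=\{v_1,v_2,v_3\}$, $V_n=\bigcup_iF_i(V_{n-1})$, and let $\Gamma_n$ be the graph on $V_n$ in which two distinct vertices are adjacent ($x\sim_n y$) iff both lie in $F_w(V_0)$ for some word $w$ of length $n$. Let $\mathbb T=\mathbb R/\mathbb Z$, with $|\theta|$ the distance of $\theta\in\mathbb T$ to $0$. For $f\in C(K,\mathbb T)$ and a finite word $w$, let $\omega_w(f)=\hat f_w(1)-\hat f_w(0)\in\mathbb Z$, where $\hat f_w:\mathbb R\to\mathbb R$ is a continuous lift of $f\circ c_w$ and $c_w:\mathbb T\to K$ is the constant-speed clockwise parametrization, starting at the leftmost vertex, of the boundary of the triangle with vertices $F_w(v_1),F_w(v_2),F_w(v_3)$. The degree of $f$ is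 the family $\bar\omega(f)=(\omega_w(f))_w$ over all finite words $w$. For $u\in C(K,\mathbb T)$ and $m$ large, let $S_mu(x)=\sum_{y\sim_m x}(u(y)-u(x))$, each difference being represented by its value in $(-1/2,1/2]$. We say $\Delta u=0$ if $\tfrac32\,5^mS_mu(x)\to0$ uniformly over $x\in V_m\setminus V_0$ as $m\to\infty$, and $\partial_{\mathbf n}u(v_i)=0$ if $(5/3)^mS_mu(v_i)\to0$. The Kuramoto model on $\Gamma_n$ is $$\dot u(t,x)=\Big(\frac53\Big)^n\sum_{y\sim_nx}\sin\big(2\pi(u(t,y)-u(t,x))\big),\qquad x\in V_n,\quad u(t,\cdot):V_n\to\mathbb T.$$ A steady state is called stable if it is Lyapunov stable for this system. **Theorem.** Let $\omega^*=(\omega^*_w)_w$ be a family of integers indexed by the finite words $w$, with only finitely many nonzero entries, and let $u^*\in C(K,\mathbb T)$ satisfy $\Delta u^*=0$, $u^*(v_1)=0$, $\partial_{\mathbf n}u^*(v_i)=0$ for $i=1,2,3$, and $\bar\omega(u^*)=\omega^*$. Then for every $\varepsilon>0$ there is $N\in\mathbb N$ such that for all $n\ge N$ the Kuramoto model on $\Gamma_n$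 has a stable steady state $u^n:V_n\to\mathbb T$ with $u^n(v_1)=0$ and $$\max_{x\in V_n}|u^n(x)-u^*(x)|<\varepsilon .$$ Moreover, $u^n$ has a continuous extension $\tilde u^n:K\to\mathbb T$ with $\bar\omega(\tilde u^n)=\omega^*$ and $$\max_{x\in K}|\tilde u^n(x)-u^*(x)|<\varepsilon .$$ -/

import Mathlib

noncomputable section

namespace SG

/-- The Euclidean plane. -/
abbrev Plane : Type := EuclideanSpace ℝ (Fin 2)

/-- The circle `𝕋 = ℝ/ℤ`; its norm is the distance to the nearest integer. -/
abbrev Circ : Type := AddCircle (1 : ℝ)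

/-! ### The Sierpinski gasket and its approximating graphs -/

/-- The corners `v₁, v₂, v₃` of the unit equilateral triangle (indexed by `0, 1, 2`). -/
def corner : Fin 3 → Plane :=
  ![!₂[0, 0], !₂[1 / 2, Real.sqrt 3 / 2], !₂[1, 0]]

/-- The contraction `F_i` with ratio `1/2` and fixed point `v_i`. -/
def F (i : Fin 3) (x : Plane) : Plane := (2⁻¹ : ℝ) • (x - corner i) + corner i

/-- `F_w = F_{w₁} ∘ ⋯ ∘ F_{wₙ}` for a finite word `w`. -/
def Fw : List (Fin 3) → Plane → Plane
  | [] => id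
  | i :: w => F i ∘ Fw w

open Classical in
/-- The vertex sets: `V₀` is the set of corners, `Vₙ₊₁ = ⋃ᵢ Fᵢ(Vₙ)`. -/
def V : ℕ → Finset Plane
  | 0 => Finset.univ.image corner
  | n + 1 => Finset.univ.biUnion fun i => (V n).image (F i)

/-- The graph `Γₙ` on `Vₙ`: two distinct vertices are adjacent iff they lie in a common
`n`-cell `F_w(V₀)`, `|w| = n`. -/
def graph (n : ℕ) : SimpleGraph (V n) where
  Adj x y := x ≠ y ∧ ∃ w : List (Fin 3), w.length = n ∧
    (x : Plane) ∈ Fw w '' (V 0 : Set Plane) ∧ (y : Plane) ∈ Fw w '' (V 0 : Set Plane)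
  symm := ⟨fun _ _ h => ⟨h.1.symm, h.2.imp fun _ hw => ⟨hw.1, hw.2.2, hw.2.1⟩⟩⟩
  loopless := ⟨fun _ h => h.1 rfl⟩

/-- The Sierpinski gasket, as the closure of the set of all vertices. By `gasket_isCompact`,
`gasket_nonempty`, `gasket_fixed` and `gasket_unique` below it is the unique nonempty compact
set with `⋃ᵢ Fᵢ(K) = K`. -/
def gasket : Set Plane := closure (⋃ n, (V n : Set Plane))

theorem F_corner (i : Fin 3) : F i (corner i) = corner i := by simp [F]

theorem dist_F (i : Fin 3) (x y : Plane) : dist (F i x) (F i y) = 2⁻¹ * dist x y := by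
  simp [F, dist_smul₀]

theorem continuous_F (i : Fin 3) : Continuous (F i) := by
  unfold F; fun_prop

theorem mem_V_succ {n : ℕ} {x : Plane} :
    x ∈ V (n + 1) ↔ ∃ i, ∃ y ∈ V n, F i y = x := by
  simp [V]

theorem corner_mem_V (i : Fin 3) (n : ℕ) : corner i ∈ V n := by
  induction n with
  | zero => simp [V]
  | succ n ih => exact mem_V_succ.2 ⟨i, _, ih, F_corner i⟩

theorem V_subset_gasket (n : ℕ) : (V n : Set Plane) ⊆ gasket :=
  (Set.subset_iUnion (fun n => (V n : Set Plane)) n).trans subset_closure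

theorem gasket_nonempty : gasket.Nonempty :=
  ⟨corner 0, V_subset_gasket 0 (corner_mem_V 0 0)⟩

theorem norm_le_of_mem_V {n : ℕ} {x : Plane} (hx : x ∈ V n) : ‖x‖ ≤ ∑ i, ‖corner i‖ := by
  have hc : ∀ i, ‖corner i‖ ≤ ∑ i, ‖corner i‖ := fun i =>
    Finset.single_le_sum (f := fun i => ‖corner i‖) (fun _ _ => norm_nonneg _)
      (Finset.mem_univ i)
  induction n generalizing x with
  | zero =>
    obtain ⟨i, -, rfl⟩ := Finset.mem_image.1 hx
    exact hc i
  | succ m ih =>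
    obtain ⟨i, y, hy, rfl⟩ := mem_V_succ.1 hx
    have h1 := ih hy
    have h2 : F i y = (2⁻¹ : ℝ) • y + (2⁻¹ : ℝ) • corner i := by
      unfold F; module
    rw [h2]
    refine (norm_add_le _ _).trans ?_
    rw [norm_smul, norm_smul]
    have := hc i
    norm_num
    linarith

theorem gasket_isCompact : IsCompact gasket := by
  refine Bornology.IsBounded.isCompact_closure ?_
  refine (Metric.isBounded_closedBall (x := (0 : Plane)) (r := ∑ i, ‖corner i‖)).subset ?_
  refine Set.iUnion_subset fun n x hx => ?_
  simpa using norm_le_of_mem_V hx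

theorem F_mem_gasket (i : Fin 3) {x : Plane} (hx : x ∈ gasket) : F i x ∈ gasket := by
  refine map_mem_closure (continuous_F i) hx ?_
  intro y hy
  obtain ⟨n, hn⟩ := Set.mem_iUnion.1 hy
  exact Set.mem_iUnion.2 ⟨n + 1, mem_V_succ.2 ⟨i, y, hn, rfl⟩⟩

theorem gasket_fixed : ⋃ i, F i '' gasket = gasket := by
  apply Set.Subset.antisymm
  · refine Set.iUnion_subset fun i => ?_
    rintro _ ⟨x, hx, rfl⟩
    exact F_mem_gasket i hx
  · refine closure_minimal ?_ ?_
    · refine Set.iUnion_subset fun n x hx => ?_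
      cases n with
      | zero =>
        obtain ⟨i, -, rfl⟩ := Finset.mem_image.1 hx
        exact Set.mem_iUnion.2 ⟨i, corner i, V_subset_gasket 0 (corner_mem_V i 0), F_corner i⟩
      | succ n =>
        obtain ⟨i, y, hy, rfl⟩ := mem_V_succ.1 hx
        exact Set.mem_iUnion.2 ⟨i, y, V_subset_gasket n hy, rfl⟩
    · exact (isCompact_iUnion fun i => gasket_isCompact.image (continuous_F i)).isClosed

theorem subset_of_selfSimilar {A B : Set Plane} (hA : IsCompact A) (hA' : A ⊆ ⋃ i, F i '' A)
    (hB : IsClosed B) (hBne : B.Nonempty) (hB' : ∀ i, ∀ x ∈ B, F i x ∈ B) : A ⊆ B := by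
  intro a ha
  obtain ⟨x, hxA, hmax⟩ :=
    hA.exists_isMaxOn ⟨a, ha⟩ (Metric.continuous_infDist_pt B).continuousOn
  obtain ⟨i, y, hyA, rfl⟩ := Set.mem_iUnion.1 (hA' hxA)
  have h1 : 2 * Metric.infDist (F i y) B ≤ Metric.infDist y B := by
    refine (Metric.le_infDist hBne).2 fun b hb => ?_
    have h := Metric.infDist_le_dist_of_mem (x := F i y) (hB' i b hb)
    rw [dist_F] at h
    linarith
  have h2 : Metric.infDist y B ≤ Metric.infDist (F i y) B := hmax hyA
  have h3 : Metric.infDist a B ≤ Metric.infDist (F i y) B := hmax ha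
  have h4 : 0 ≤ Metric.infDist a B := Metric.infDist_nonneg
  exact (hB.mem_iff_infDist_zero hBne).2 (by linarith)

theorem gasket_unique {K : Set Plane} (hK : IsCompact K) (hne : K.Nonempty)
    (hfix : ⋃ i, F i '' K = K) : K = gasket := by
  apply Set.Subset.antisymm
  · exact subset_of_selfSimilar hK hfix.ge gasket_isCompact.isClosed gasket_nonempty
      fun i x hx => F_mem_gasket i hx
  · refine subset_of_selfSimilar gasket_isCompact gasket_fixed.ge hK.isClosed hne ?_
    intro i x hx
    exact hfix.le (Set.mem_iUnion.2 ⟨i, x, hx, rfl⟩)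

/-- The inclusion `Vₙ ⊆ K`. -/
def incl {n : ℕ} (x : V n) : gasket := ⟨x, V_subset_gasket n x.2⟩

/-- The corner `v_i` as a vertex of `Γₙ`. -/
def cornerV (n : ℕ) (i : Fin 3) : V n := ⟨corner i, corner_mem_V i n⟩

/-! ### The degree of a continuous map from the gasket to the circle -/

/-- The `1`-periodic constant-speed clockwise parametrization `v₁ → v₂ → v₃ → v₁` of the
boundary of the unit triangle. -/
def perimeter (t : ℝ) : Plane :=
  if Int.fract t ≤ 1 / 3 then
    AffineMap.lineMap (corner 0) (corner 1) (3 * Int.fract t)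
  else if Int.fract t ≤ 2 / 3 then
    AffineMap.lineMap (corner 1) (corner 2) (3 * Int.fract t - 1)
  else
    AffineMap.lineMap (corner 2) (corner 0) (3 * Int.fract t - 2)

theorem segment_subset_gasket (i j : Fin 3) : segment ℝ (corner i) (corner j) ⊆ gasket := by
  refine subset_of_selfSimilar ?_ ?_ gasket_isCompact.isClosed gasket_nonempty
    fun i x hx => F_mem_gasket i hx
  · rw [segment_eq_image_lineMap]
    exact isCompact_Icc.image AffineMap.lineMap_continuous
  · intro x hx
    rw [segment_eq_image_lineMap] at hx ⊢
    obtain ⟨t, ⟨h0, h1⟩, rfl⟩ := hx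
    rcases le_total t (1 / 2) with h | h
    · refine Set.mem_iUnion.2 ⟨i, _, ⟨2 * t, ⟨by linarith, by linarith⟩, rfl⟩, ?_⟩
      simp only [F, AffineMap.lineMap_apply_module']
      module
    · refine Set.mem_iUnion.2 ⟨j, _, ⟨2 * t - 1, ⟨by linarith, by linarith⟩, rfl⟩, ?_⟩
      simp only [F, AffineMap.lineMap_apply_module']
      module

theorem perimeter_mem_gasket (t : ℝ) : perimeter t ∈ gasket := by
  have h0 := Int.fract_nonneg t
  have h1 := Int.fract_lt_one t
  have key : ∀ i j : Fin 3, ∀ s : ℝ, 0 ≤ s → s ≤ 1 →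
      AffineMap.lineMap (corner i) (corner j) s ∈ gasket := by
    intro i j s hs hs'
    apply segment_subset_gasket i j
    rw [segment_eq_image_lineMap]
    exact ⟨s, ⟨hs, hs'⟩, rfl⟩
  unfold perimeter
  split_ifs with h h'
  · exact key _ _ _ (by linarith) (by linarith)
  · exact key _ _ _ (by linarith) (by linarith)
  · exact key _ _ _ (by linarith) (by linarith)

theorem Fw_mem_gasket (w : List (Fin 3)) {x : Plane} (hx : x ∈ gasket) : Fw w x ∈ gasket := by
  induction w with
  | nil => exact hx
  | cons i w ih => exact F_mem_gasket i ih

/-- The clockwise constant-speed parametrization of the triangular loop `∂T_w = F_w(∂T)`,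
starting at its leftmost vertex `F_w(v₁)`. -/
def loop (w : List (Fin 3)) (t : ℝ) : gasket :=
  ⟨Fw w (perimeter t), Fw_mem_gasket w (perimeter_mem_gasket t)⟩

/-- `g` is a (continuous, real-valued) lift of the restriction of `f` to the loop `∂T_w`. -/
def IsLoopLift (f : C(gasket, Circ)) (w : List (Fin 3)) (g : ℝ → ℝ) : Prop :=
  Continuous g ∧ ∀ t : ℝ, (g t : Circ) = f (loop w t)

/-- The degree of `f` is the finitely supported family `ω` of integers, indexed by the
triangular loops `∂T_w`: along each `∂T_w` the lift of `f` grows by `ω w`. -/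
def HasDegree (f : C(gasket, Circ)) (ω : List (Fin 3) →₀ ℤ) : Prop :=
  ∀ w : List (Fin 3), ∃ g : ℝ → ℝ, IsLoopLift f w g ∧ g 1 - g 0 = (ω w : ℝ)

/-! ### Harmonic maps from the gasket to the circle -/

/-- The representative of `θ ∈ ℝ/ℤ` in `(-1/2, 1/2]`. For a continuous circle-valued `u` and
nearby points `x, y` it turns `u y - u x` into the increment of any local real lift of `u`. -/
def rep (θ : Circ) : ℝ := (AddCircle.equivIoc (1 : ℝ) (-1 / 2) θ : ℝ)

open Classical in
/-- The sum over the neighbours `y ∼ₘ x` of the (lifted) increments `u y - u x`. -/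
def increments (u : C(gasket, Circ)) (m : ℕ) (x : V m) : ℝ :=
  ∑ y ∈ (graph m).neighborFinset x, rep (u (incl y) - u (incl x))

/-- `Δ u = g` on the gasket: the renormalized graph Laplacians
`(3/2) 5ᵐ ∑_{y ∼ₘ x} (u y - u x)` converge to `g`, uniformly over `x ∈ Vₘ \ V₀`. -/
def HasLaplacian (u : C(gasket, Circ)) (g : C(gasket, ℝ)) : Prop :=
  ∀ ε > 0, ∃ M : ℕ, ∀ m ≥ M, ∀ x : V m, (x : Plane) ∉ V 0 →
    |3 / 2 * (5 : ℝ) ^ m * increments u m x - g (incl x)| < ε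

/-- The normal derivative of `u` at the boundary vertex `v_i` exists and equals `d`. -/
def HasNormalDeriv (u : C(gasket, Circ)) (i : Fin 3) (d : ℝ) : Prop :=
  Filter.Tendsto (fun m : ℕ => (5 / 3 : ℝ) ^ m * increments u m (cornerV m i))
    Filter.atTop (nhds d)

/-- `u` solves the boundary value problem: `Δ u = 0`, `u(v₁) = 0`, zero normal derivatives on
`V₀`, and degree `ω`. -/
structure IsHarmonicMap (u : C(gasket, Circ)) (ω : List (Fin 3) →₀ ℤ) : Prop where
  laplacian : HasLaplacian u 0
  base : u (incl (cornerV 0 0)) = 0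
  neumann : ∀ i : Fin 3, HasNormalDeriv u i 0
  degree : HasDegree u ω

/-! ### The Kuramoto model -/

/-- The function `θ ↦ sin (2πθ)` on the circle `ℝ/ℤ`. -/
def sinCirc (θ : Circ) : ℝ := (AddCircle.toCircle θ : ℂ).im

theorem sinCirc_coe (x : ℝ) : sinCirc (x : Circ) = Real.sin (2 * Real.pi * x) := by
  have h := Complex.exp_ofReal_mul_I_im (2 * Real.pi * x)
  push_cast at h
  simpa [sinCirc, AddCircle.toCircle_apply_mk, Circle.coe_exp] using h

open Classical in
/-- The right-hand side of the Kuramoto model on `Γₙ`: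
`(5/3)ⁿ ∑_{y ∼ₙ x} sin (2π (u y - u x))`. -/
def kuramotoField (n : ℕ) (u : V n → Circ) (x : V n) : ℝ :=
  (5 / 3 : ℝ) ^ n * ∑ y ∈ (graph n).neighborFinset x, sinCirc (u y - u x)

/-- `U` solves the Kuramoto model on `Γₙ` for `t ≥ 0`; time derivatives of circle-valued
functions are taken through a real lift `φ`. -/
def IsKuramotoSolution (n : ℕ) (U : ℝ → V n → Circ) : Prop :=
  ∃ φ : ℝ → V n → ℝ, ∀ t : ℝ, 0 ≤ t → ∀ x : V n,
    (φ t x : Circ) = U t x ∧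
      HasDerivWithinAt (fun s => φ s x) (kuramotoField n (U t) x) (Set.Ici 0) t

/-- Steady states of the Kuramoto model. -/
def IsSteadyState (n : ℕ) (u : V n → Circ) : Prop := ∀ x : V n, kuramotoField n u x = 0

/-- (Lyapunov) stability of a state of the Kuramoto model. -/
def IsStable (n : ℕ) (u : V n → Circ) : Prop :=
  ∀ ε > 0, ∃ δ > 0, ∀ U : ℝ → V n → Circ, IsKuramotoSolution n U →
    (∀ x, ‖U 0 x - u x‖ < δ) → ∀ t : ℝ, 0 ≤ t → ∀ x, ‖U t x - u x‖ < ε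

end SG

end

/-! On cells where `u` oscillates little it has a real lift, and the 1/5–2/5 rule of the gasket
expresses the Laplacian sum at level `m` as 5/3 of the sum at level `m + 1` plus a weighted average
of the sums at midpoints (`SmallOn.cellLap_eq`). Hence the supremum of `5^m |S_m u|` off `V 0` is at
most that of the next fine level. It tends to 0, so `S_m u` vanishes exactly on all fine levels; the
Neumann condition then gives the same at the corners (`vertexSum_cellLap_eq_zero`), and the
renormalized energy of `u` is constant in `n` (`circEnergy_eq`).

At level `n` the increments `a = 2π (u y - u x)` thus form a divergence-free flow with `∑ a²` equal
to `(3/5)^n` times a constant and entries at most `α`, where `α` is as small as desired by uniform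
continuity. A steady state is sought as `u + v/(2π)` with `v` real. In `exists_sine_equilibrium`,
`-∑ cos (a + ∇v)` is minimized over a ball of Dirichlet energy `(3/5)^n r`. The term linear in `∇v`
vanishes and the remaining error is of order `α⁴ ∑ a²`, so the minimizer is interior, hence
critical. The Sobolev inequality `sq_le_energy` converts the energy bound into a uniform bound on
`v` in which the powers of 5/3 cancel.

Stability holds because all phase differences lie where sine increases, so the `ℓ²` distance to the
equilibrium cannot grow (`sum_sq_lt_of_sine_flow`). The correction is real-valued, extends to the
gasket by Tietze, and leaves all winding numbers unchanged (`HasDegree.add_real`). -/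

namespace SG

/-! ### Barycentric coordinates and addresses of vertices -/

/-- Barycentric coordinates with respect to the three corners. -/
noncomputable def bary (x : Plane) : Fin 3 → ℝ :=
  ![1 - x 0 - x 1 / Real.sqrt 3, 2 * x 1 / Real.sqrt 3, x 0 - x 1 / Real.sqrt 3]

theorem bary_corner (i k : Fin 3) : bary (corner i) k = if k = i then 1 else 0 := by
  have h : Real.sqrt 3 ≠ 0 := by positivity
  fin_cases i <;> fin_cases k <;> simp [bary, corner] <;> field_simp <;> norm_num

theorem bary_F (i k : Fin 3) (x : Plane) :
    bary (F i x) k = (bary x k + if k = i then 1 else 0) / 2 := by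
  have h : Real.sqrt 3 ≠ 0 := by positivity
  fin_cases i <;> fin_cases k <;> simp [bary, F, corner] <;> field_simp <;> ring

theorem bary_sum (x : Plane) : bary x 0 + bary x 1 + bary x 2 = 1 := by
  simp [bary]; ring

theorem bary_injective {x y : Plane} (h : ∀ k, bary x k = bary y k) : x = y := by
  have hs : Real.sqrt 3 ≠ 0 := by positivity
  have h1 := h 1
  have h2 := h 2
  simp only [bary, Matrix.cons_val_one, Matrix.cons_val_zero, Matrix.cons_val] at h1 h2
  have h3 : x 1 = y 1 := by field_simp at h1; linarith
  rw [h3] at h2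
  ext k
  fin_cases k
  · simpa using h2
  · simpa using h3

theorem corner_injective : Function.Injective corner := by
  intro i j h
  by_contra hij
  have h1 := bary_corner i i
  rw [h, bary_corner, if_pos rfl, if_neg hij] at h1
  norm_num at h1

theorem F_injective (i : Fin 3) : Function.Injective (F i) := by
  intro x y h
  have := dist_F i x y
  rw [h, dist_self] at this
  exact dist_eq_zero.1 (by linarith)

/-- Both sides are the midpoint of `v_i` and `v_k`: this is how neighbouring cells are glued. -/
theorem F_corner_comm (i k : Fin 3) : F i (corner k) = F k (corner i) := by
  apply bary_injective
  intro l
  simp only [bary_F, bary_corner]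
  ring

theorem Fw_injective (w : List (Fin 3)) : Function.Injective (Fw w) := by
  induction w with
  | nil => exact Function.injective_id
  | cons i w ih => exact (F_injective i).comp ih

theorem Fw_append_singleton (w : List (Fin 3)) (k : Fin 3) (x : Plane) :
    Fw (w ++ [k]) x = Fw w (F k x) := by
  induction w with
  | nil => rfl
  | cons i w ih => exact congrArg (F i) ih

theorem dist_Fw (w : List (Fin 3)) (x y : Plane) :
    dist (Fw w x) (Fw w y) = (2⁻¹ : ℝ) ^ w.length * dist x y := by
  induction w with
  | nil => simp [Fw]
  | cons i w ih => simp [Fw, dist_F, ih, pow_succ]; ring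

theorem bary_nonneg_of_mem_V {n : ℕ} {x : Plane} (hx : x ∈ V n) (k : Fin 3) : 0 ≤ bary x k := by
  induction n generalizing x with
  | zero =>
    obtain ⟨i, -, rfl⟩ := Finset.mem_image.1 hx
    rw [bary_corner]; split_ifs <;> norm_num
  | succ n ih =>
    obtain ⟨i, y, hy, rfl⟩ := mem_V_succ.1 hx
    have := ih hy
    rw [bary_F]; split_ifs <;> linarith

theorem eq_corner_of_one_le_bary {x : Plane} (hx : ∀ k, 0 ≤ bary x k) {k : Fin 3}
    (h : 1 ≤ bary x k) : x = corner k := by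
  apply bary_injective
  intro l
  have hs := bary_sum x
  have h0 := hx 0
  have h1 := hx 1
  have h2 := hx 2
  rw [bary_corner]
  fin_cases k <;> fin_cases l <;> simp at h ⊢ <;> linarith

/-- Distinct first-level cells only meet at the common midpoint of their corners. -/
theorem eq_corner_of_F_eq_F {x y : Plane} (hx : ∀ k, 0 ≤ bary x k) (hy : ∀ k, 0 ≤ bary y k)
    {i k : Fin 3} (hik : i ≠ k) (h : F i x = F k y) : x = corner k ∧ y = corner i := by
  have hi := bary_F i i x
  have hk := bary_F i k x
  rw [h, bary_F] at hi hk
  rw [if_neg hik, if_pos rfl] at hi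
  rw [if_neg hik.symm, if_pos rfl] at hk
  -- Comparing coordinates gives `bary x k = bary y k + 1` and `bary y i = bary x i + 1`, both at
  -- least 1.
  exact ⟨eq_corner_of_one_le_bary hx (by linarith [hy k]),
    eq_corner_of_one_le_bary hy (by linarith [hx i])⟩

theorem mem_V_iff {n : ℕ} {x : Plane} :
    x ∈ V n ↔ ∃ w : List (Fin 3), w.length = n ∧ ∃ i, Fw w (corner i) = x := by
  induction n generalizing x with
  | zero => simp [V, Fw]
  | succ n ih =>
    rw [mem_V_succ]
    constructor
    · rintro ⟨i, y, hy, rfl⟩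
      obtain ⟨w, hw, j, rfl⟩ := ih.1 hy
      exact ⟨i :: w, by simp [hw], j, rfl⟩
    · rintro ⟨w, hw, j, rfl⟩
      obtain ⟨i, w, rfl⟩ := List.exists_cons_of_length_eq_add_one hw
      exact ⟨i, _, ih.2 ⟨w, by simpa using hw, j, rfl⟩, rfl⟩

theorem Fw_corner_mem_V (w : List (Fin 3)) (i : Fin 3) : Fw w (corner i) ∈ V w.length :=
  mem_V_iff.2 ⟨w, rfl, i, rfl⟩

theorem V_subset_succ (n : ℕ) : V n ⊆ V (n + 1) := by
  intro x hx
  obtain ⟨w, rfl, i, rfl⟩ := mem_V_iff.1 hx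
  refine mem_V_iff.2 ⟨w ++ [i], by simp, i, ?_⟩
  rw [Fw_append_singleton, F_corner]

theorem V_mono {m n : ℕ} (h : m ≤ n) : V m ⊆ V n :=
  monotone_nat_of_le_succ V_subset_succ h

theorem Fw_F_corner_mem_V (w : List (Fin 3)) (k i : Fin 3) :
    Fw w (F k (corner i)) ∈ V (w.length + 1) := by
  rw [← Fw_append_singleton]
  simpa using Fw_corner_mem_V (w ++ [k]) i

/-- An edge of `Γₙ` lies in a unique `n`-cell. -/
theorem eq_of_edge_eq {w w' : List (Fin 3)} (hl : w.length = w'.length) {i j i' j' : Fin 3}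
    (hij : i ≠ j) (hi : Fw w (corner i) = Fw w' (corner i'))
    (hj : Fw w (corner j) = Fw w' (corner j')) : w = w' ∧ i = i' ∧ j = j' := by
  induction w generalizing w' with
  | nil =>
    obtain rfl := List.length_eq_zero_iff.1 hl.symm
    exact ⟨rfl, corner_injective hi, corner_injective hj⟩
  | cons a w ih =>
    obtain ⟨b, w', rfl⟩ := List.exists_cons_of_length_eq_add_one hl.symm
    by_cases hab : a = b
    · subst hab
      obtain ⟨rfl, h⟩ := ih (w' := w') (by simpa using hl) (F_injective a hi) (F_injective a hj)
      exact ⟨rfl, h⟩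
    -- Cells with different first letters share one point only, which would have to be both ends of
    -- the edge.
    · have h1 := eq_corner_of_F_eq_F (bary_nonneg_of_mem_V (Fw_corner_mem_V w i))
        (bary_nonneg_of_mem_V (Fw_corner_mem_V w' i')) hab hi
      have h2 := eq_corner_of_F_eq_F (bary_nonneg_of_mem_V (Fw_corner_mem_V w j))
        (bary_nonneg_of_mem_V (Fw_corner_mem_V w' j')) hab hj
      exact absurd (corner_injective (Fw_injective w (h1.1.trans h2.1.symm))) hij

/-- The midpoints of an `n`-cell are not vertices of level `n`. -/
theorem eq_of_midpoint_mem_V {w : List (Fin 3)} {k i : Fin 3}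
    (h : Fw w (F k (corner i)) ∈ V w.length) : k = i := by
  induction w with
  | nil =>
    obtain ⟨l, -, hl⟩ := Finset.mem_image.1 h
    have hl' : F l (corner l) = F k (corner i) := by rw [F_corner, hl]; rfl
    by_cases hk : l = k
    · subst hk
      exact corner_injective (F_injective l hl')
    · have := eq_corner_of_F_eq_F (bary_nonneg_of_mem_V (corner_mem_V l 0))
        (bary_nonneg_of_mem_V (corner_mem_V i 0)) hk hl'
      exact absurd (corner_injective this.1) hk
  | cons a w ih =>
    obtain ⟨b, y, hy, hby⟩ := mem_V_succ.1 h
    by_cases hab : b = a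
    · subst hab
      exact ih (F_injective b hby ▸ hy)
    · have := eq_corner_of_F_eq_F (bary_nonneg_of_mem_V hy)
        (bary_nonneg_of_mem_V (Fw_F_corner_mem_V w k i)) hab hby
      exact ih (this.2 ▸ corner_mem_V b _)

/-- A midpoint of an `n`-cell determines that cell. -/
theorem eq_of_midpoint_eq {w w' : List (Fin 3)} (hl : w.length = w'.length) {k i k' i' : Fin 3}
    (hki : k ≠ i) (h : Fw w (F k (corner i)) = Fw w' (F k' (corner i'))) :
    w = w' ∧ ((k = k' ∧ i = i') ∨ (k = i' ∧ i = k')) := by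
  induction w generalizing w' with
  | nil =>
    obtain rfl := List.length_eq_zero_iff.1 hl.symm
    refine ⟨rfl, ?_⟩
    have h' : F k (corner i) = F k' (corner i') := h
    by_cases hk : k = k'
    · subst hk
      exact Or.inl ⟨rfl, corner_injective (F_injective k h')⟩
    · have := eq_corner_of_F_eq_F (bary_nonneg_of_mem_V (corner_mem_V i 0))
        (bary_nonneg_of_mem_V (corner_mem_V i' 0)) hk h'
      exact Or.inr ⟨(corner_injective this.2).symm, corner_injective this.1⟩
  | cons a w ih =>
    obtain ⟨b, w', rfl⟩ := List.exists_cons_of_length_eq_add_one hl.symm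
    by_cases hab : a = b
    · subst hab
      obtain ⟨rfl, h'⟩ := ih (w' := w') (by simpa using hl) (F_injective a h)
      exact ⟨rfl, h'⟩
    -- A point shared by different first-level cells is a corner of each, whereas a midpoint of `w`
    -- is not a vertex of level `w.length`.
    · have := eq_corner_of_F_eq_F (bary_nonneg_of_mem_V (Fw_F_corner_mem_V w k i))
        (bary_nonneg_of_mem_V (Fw_F_corner_mem_V w' k' i')) hab h
      exact absurd (eq_of_midpoint_mem_V (this.1 ▸ corner_mem_V b w.length)) hki

/-! ### Sums over cells -/

/-- The words of length `n`. -/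
def words (n : ℕ) : Finset (List (Fin 3)) :=
  (Finset.univ : Finset (List.Vector (Fin 3) n)).map ⟨List.Vector.toList, Subtype.val_injective⟩

theorem mem_words {n : ℕ} {w : List (Fin 3)} : w ∈ words n ↔ w.length = n := by
  simp only [words, Finset.mem_map, Finset.mem_univ, true_and]
  exact ⟨fun ⟨v, hv⟩ => hv ▸ v.2, fun h => ⟨⟨w, h⟩, rfl⟩⟩

/-- Appending the letter at the end subdivides each cell in place; prepending it would shrink the
whole gasket instead. -/
theorem sum_words_succ {M : Type*} [AddCommMonoid M] (n : ℕ) (f : List (Fin 3) → M) :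
    ∑ w ∈ words (n + 1), f w = ∑ w ∈ words n, ∑ k, f (w ++ [k]) := by
  rw [← Finset.sum_product']
  symm
  refine Finset.sum_bij (fun p _ => p.1 ++ [p.2]) ?_ ?_ ?_ ?_
  · intro p hp
    simp [mem_words] at hp ⊢
    exact hp
  · intro p _ q _ h
    obtain ⟨h1, h2⟩ := List.append_inj' h rfl
    exact Prod.ext h1 (by simpa using h2)
  · intro w hw
    rw [mem_words] at hw
    have hne : w ≠ [] := by rintro rfl; simp at hw
    refine ⟨(w.dropLast, w.getLast hne), ?_, List.dropLast_append_getLast hne⟩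
    simp [mem_words, hw]
  · intro p _; rfl

open Classical in
/-- Sums over neighbours in `Γₙ`, cell by cell. -/
theorem sum_neighborFinset {n : ℕ} (x : V n) (g : Plane → ℝ) (hg : g x = 0) :
    ∑ y ∈ (graph n).neighborFinset x, g y =
      ∑ w ∈ words n, ∑ i, if Fw w (corner i) = x then ∑ j, g (Fw w (corner j)) else 0 := by
  -- Since `g x = 0`, the diagonal term `j = i` may be dropped, leaving genuine neighbours only.
  have h1 : ∀ w ∈ words n, ∀ i ∈ (Finset.univ : Finset (Fin 3)),
      (if Fw w (corner i) = x then ∑ j, g (Fw w (corner j)) else 0) =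
      ∑ j, if Fw w (corner i) = x ∧ i ≠ j then g (Fw w (corner j)) else 0 := by
    intro w _ i _
    split_ifs with h
    · refine Finset.sum_congr rfl fun j _ => ?_
      by_cases hij : i = j
      · subst hij; simp [h, hg]
      · simp [h, hij]
    · simp [h]
  rw [Finset.sum_congr rfl fun w hw => Finset.sum_congr rfl (h1 w hw)]
  have h2 : (∑ w ∈ words n, ∑ i, ∑ j,
      if Fw w (corner i) = x ∧ i ≠ j then g (Fw w (corner j)) else 0) =
      ∑ p ∈ ((words n ×ˢ Finset.univ) ×ˢ Finset.univ).filter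
        (fun p : (List (Fin 3) × Fin 3) × Fin 3 => Fw p.1.1 (corner p.1.2) = x ∧ p.1.2 ≠ p.2),
        g (Fw p.1.1 (corner p.2)) := by
    rw [Finset.sum_filter, Finset.sum_product, Finset.sum_product]
  rw [h2]
  symm
  refine Finset.sum_bij (fun p hp => ⟨Fw p.1.1 (corner p.2), ?_⟩) ?_ ?_ ?_ ?_
  · simp only [Finset.mem_filter, Finset.mem_product, mem_words] at hp
    exact hp.1.1.1 ▸ Fw_corner_mem_V _ _
  · intro p hp
    simp only [Finset.mem_filter, Finset.mem_product, mem_words] at hp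
    rw [SimpleGraph.mem_neighborFinset]
    refine ⟨?_, p.1.1, hp.1.1.1, ?_, ?_⟩
    · intro h
      have h' : (x : Plane) = Fw p.1.1 (corner p.2) := congrArg Subtype.val h
      exact hp.2.2 (corner_injective (Fw_injective _ (hp.2.1.trans h')))
    · exact ⟨corner p.1.2, corner_mem_V _ 0, hp.2.1⟩
    · exact ⟨corner p.2, corner_mem_V _ 0, rfl⟩
  · rintro ⟨⟨w, i⟩, j⟩ hp ⟨⟨w', i'⟩, j'⟩ hq h
    simp only [Finset.mem_filter, Finset.mem_product, mem_words] at hp hq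
    obtain ⟨rfl, rfl, rfl⟩ := eq_of_edge_eq (hp.1.1.1.trans hq.1.1.1.symm) hp.2.2
      (hp.2.1.trans hq.2.1.symm) (congrArg Subtype.val h)
    rfl
  · intro y hy
    rw [SimpleGraph.mem_neighborFinset] at hy
    obtain ⟨hne, w, hw, ⟨a, ha, hax⟩, ⟨b, hb, hby⟩⟩ := hy
    obtain ⟨i, -, rfl⟩ := Finset.mem_image.1 ha
    obtain ⟨j, -, rfl⟩ := Finset.mem_image.1 hb
    refine ⟨((w, i), j), ?_, Subtype.ext hby⟩
    simp only [Finset.mem_filter, Finset.mem_product, mem_words, Finset.mem_univ, and_true]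
    refine ⟨hw, hax, ?_⟩
    rintro rfl
    exact hne (Subtype.ext (hax.symm.trans hby))
  · intro p _; rfl

open Classical in
/-- Sums over oriented edges of `Γₙ`, cell by cell. -/
theorem sum_edges (n : ℕ) (g : Plane → Plane → ℝ) (hg : ∀ x, g x x = 0) :
    ∑ x : V n, ∑ y ∈ (graph n).neighborFinset x, g x y =
      ∑ w ∈ words n, ∑ i, ∑ j, g (Fw w (corner i)) (Fw w (corner j)) := by
  rw [Finset.sum_congr rfl fun x _ => sum_neighborFinset x (g x) (hg x), Finset.sum_comm]
  refine Finset.sum_congr rfl fun w hw => ?_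
  rw [Finset.sum_comm]
  refine Finset.sum_congr rfl fun i _ => ?_
  rw [Finset.sum_eq_single (⟨Fw w (corner i), mem_words.1 hw ▸ Fw_corner_mem_V w i⟩ : V n)]
  · simp
  · intro b _ hb
    rw [if_neg]
    intro h
    exact hb (Subtype.ext h.symm)
  · simp

/-! ### Sine-coupled networks on a finite graph -/

section Network

variable {X : Type*} [Fintype X]

theorem sum_neighbors_swap {N : X → Finset X} (hN : ∀ x y, y ∈ N x → x ∈ N y)
    (f : X → X → ℝ) : ∑ x, ∑ y ∈ N x, f x y = ∑ x, ∑ y ∈ N x, f y x :=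
  Finset.sum_comm' fun x y => by simpa using ⟨hN x y, hN y x⟩

/-- Summation by parts; the factor 2 appears because each edge is counted in both orientations. -/
theorem sum_neighbors_mul_sub {N : X → Finset X} (hN : ∀ x y, y ∈ N x → x ∈ N y)
    {a : X → X → ℝ} (ha : ∀ x, ∀ y ∈ N x, a y x = -a x y) (v : X → ℝ) :
    ∑ x, ∑ y ∈ N x, a x y * (v y - v x) = -2 * ∑ x, v x * ∑ y ∈ N x, a x y := by
  have h1 : ∑ x, ∑ y ∈ N x, a x y * v y = -∑ x, v x * ∑ y ∈ N x, a x y := by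
    rw [sum_neighbors_swap hN, ← Finset.sum_neg_distrib]
    refine Finset.sum_congr rfl fun x _ => ?_
    rw [Finset.mul_sum, ← Finset.sum_neg_distrib]
    refine Finset.sum_congr rfl fun y hy => ?_
    rw [ha x y hy]; ring
  have h2 : ∑ x, ∑ y ∈ N x, a x y * v x = ∑ x, v x * ∑ y ∈ N x, a x y := by
    refine Finset.sum_congr rfl fun x _ => ?_
    rw [Finset.mul_sum]
    exact Finset.sum_congr rfl fun y _ => mul_comm _ _
  simp only [mul_sub, Finset.sum_sub_distrib]
  rw [h1, h2]; ring

/-! ### Elementary estimates for sine and cosine -/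

theorem abs_sin_sub_le {x : ℝ} (hx : |x| ≤ 1) : |Real.sin x - x| ≤ |x| ^ 3 / 4 := by
  have h1 := Real.sin_bound hx
  have h2 : Real.sin x - x = (Real.sin x - (x - x ^ 3 / 6)) - x ^ 3 / 6 := by ring
  have h3 : |x ^ 3 / 6| = |x| ^ 3 / 6 := by rw [abs_div, abs_pow]; norm_num
  have h4 : |x| ^ 5 ≤ |x| ^ 3 := pow_le_pow_of_le_one (abs_nonneg x) hx (by norm_num)
  have h5 : (0 : ℝ) ≤ |x| ^ 3 := by positivity
  rw [h2]
  refine (abs_sub _ _).trans ?_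
  rw [h3]
  linarith

/-- Expand `cos A (1 - cos D) + sin A sin D`. The first term is at least `(99/100) D²/5`; replacing
`sin A sin D` by `A D` costs at most `D²/40 + D²/8 + A⁶/8`. The point is that `A D` stays exact,
since it will sum to zero, and that the loss in `A` is of sixth order. -/
theorem cos_sub_cos_add_lower {A D : ℝ} (hA : |A| ≤ 1 / 10) (hD : |D| ≤ 1 / 10) :
    A * D + D ^ 2 / 40 - A ^ 6 / 8 ≤ Real.cos A - Real.cos (A + D) := by
  have hA2 : A ^ 2 ≤ 1 / 100 := by
    rw [← sq_abs]; nlinarith [abs_nonneg A]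
  have hD2 : D ^ 2 ≤ 1 / 100 := by
    rw [← sq_abs]; nlinarith [abs_nonneg D]
  have h1 : 99 / 100 ≤ Real.cos A := by
    have := Real.one_sub_sq_div_two_le_cos (x := A)
    linarith
  have h2 : D ^ 2 / 5 ≤ 1 - Real.cos D := by
    have h := (abs_le.1 (Real.cos_bound (x := D) (by linarith))).2
    have h' : |D| ^ 4 ≤ D ^ 2 / 100 := by
      rw [show |D| ^ 4 = (|D| ^ 2) ^ 2 by ring, sq_abs]; nlinarith [sq_nonneg D]
    nlinarith [sq_nonneg D]
  have h3 : |Real.sin A * (Real.sin D - D)| ≤ D ^ 2 / 40 := by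
    rw [abs_mul]
    have e1 := Real.abs_sin_le_one A
    have e2 := abs_sin_sub_le (x := D) (by linarith)
    have e3 : |D| ^ 3 / 4 ≤ D ^ 2 / 40 := by
      rw [← sq_abs D]; nlinarith [sq_nonneg |D|]
    nlinarith [abs_nonneg (Real.sin D - D), abs_nonneg (Real.sin A)]
  have h4 : |(Real.sin A - A) * D| ≤ A ^ 6 / 8 + D ^ 2 / 8 := by
    rw [abs_mul]
    have e2 := abs_sin_sub_le (x := A) (by linarith)
    have e3 : (|A| ^ 3) ^ 2 = A ^ 6 := by
      rw [← pow_mul, ← abs_pow, abs_of_nonneg (Even.pow_nonneg (by decide) A)]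
    have e4 : |A| ^ 3 * |D| ≤ (A ^ 6 + D ^ 2) / 2 := by
      rw [← e3, ← sq_abs D]; nlinarith [sq_nonneg (|A| ^ 3 - |D|)]
    nlinarith [abs_nonneg D]
  rw [Real.cos_add]
  have h5 := (abs_le.1 h3).1
  have h6 := (abs_le.1 h4).1
  nlinarith [sq_nonneg D]

/-- The Dirichlet energy of `v`, summed over oriented edges. -/
def dirichlet (N : X → Finset X) (v : X → ℝ) : ℝ := ∑ x, ∑ y ∈ N x, (v y - v x) ^ 2

theorem sq_sub_le_dirichlet {N : X → Finset X} (v : X → ℝ) {x y : X} (hy : y ∈ N x) :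
    (v y - v x) ^ 2 ≤ dirichlet N v := by
  refine (Finset.single_le_sum (f := fun y => (v y - v x) ^ 2)
    (fun _ _ => sq_nonneg _) hy).trans ?_
  exact Finset.single_le_sum (f := fun x => ∑ y ∈ N x, (v y - v x) ^ 2)
    (fun _ _ => Finset.sum_nonneg fun _ _ => sq_nonneg _) (Finset.mem_univ x)

theorem continuous_dirichlet (N : X → Finset X) : Continuous (dirichlet N) := by
  unfold dirichlet; fun_prop

/-- A divergence-free flow `a` with small entries can be corrected by a gradient of small energy
to a flow whose sines are divergence-free. The correction minimizes `-∑ cos`. -/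
theorem exists_sine_equilibrium [DecidableEq X] {N : X → Finset X}
    (hN : ∀ x y, y ∈ N x → x ∈ N y) {a : X → X → ℝ} (ha : ∀ x, ∀ y ∈ N x, a y x = -a x y)
    (hdiv : ∀ x, ∑ y ∈ N x, a x y = 0) {α ρ K : ℝ} (haα : ∀ x, ∀ y ∈ N x, |a x y| ≤ α)
    (hα : α ≤ 1 / 10) (hρ : 0 < ρ) (hρ' : ρ ≤ 1 / 100) (hK : 0 ≤ K) (x₀ : X)
    (hS : ∀ v : X → ℝ, v x₀ = 0 → ∀ x, v x ^ 2 ≤ K * dirichlet N v)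
    (hE : 5 * α ^ 4 * ∑ x, ∑ y ∈ N x, a x y ^ 2 < ρ) :
    ∃ v : X → ℝ, v x₀ = 0 ∧ dirichlet N v ≤ ρ ∧
      ∀ x, ∑ y ∈ N x, Real.sin (a x y + (v y - v x)) = 0 := by
  set J : (X → ℝ) → ℝ := fun v => ∑ x, ∑ y ∈ N x, -Real.cos (a x y + (v y - v x)) with hJ
  have hJc : Continuous J := by rw [hJ]; fun_prop
  set B : Set (X → ℝ) := {v | v x₀ = 0 ∧ dirichlet N v ≤ ρ} with hB
  -- The normalization at `x₀` together with `hS` bounds every value: `v x ^ 2 ≤ K ρ ≤ (K ρ + 1) ^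
  -- 2`.
  have hBc : IsCompact B := by
    refine (isCompact_univ_pi fun _ : X => isCompact_Icc (a := -(K * ρ + 1))
      (b := K * ρ + 1)).of_isClosed_subset ?_ ?_
    · exact (isClosed_eq (continuous_apply x₀) continuous_const).inter
        (isClosed_le (continuous_dirichlet N) continuous_const)
    · rintro v ⟨h0, h1⟩ x -
      have h2 := hS v h0 x
      have h3 : K * dirichlet N v ≤ K * ρ := mul_le_mul_of_nonneg_left h1 hK
      have h4 : 0 ≤ K * ρ := by positivity
      exact abs_le.1 (abs_le_of_sq_le_sq (by nlinarith) (by linarith))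
  have h0B : (0 : X → ℝ) ∈ B := by
    refine ⟨rfl, ?_⟩
    simpa [dirichlet] using hρ.le
  obtain ⟨v, ⟨hv0, hvρ⟩, hmin⟩ := hBc.exists_isMinOn ⟨0, h0B⟩ hJc.continuousOn
  -- The linear terms cancel because `a` is divergence-free; `a⁶ ≤ α⁴ a²` brings the error down to
  -- the energy of `a`.
  have hlow : dirichlet N v / 40 - α ^ 4 * (∑ x, ∑ y ∈ N x, a x y ^ 2) / 8 ≤ J v - J 0 := by
    have e1 : J v - J 0 = ∑ x, ∑ y ∈ N x,
        (Real.cos (a x y) - Real.cos (a x y + (v y - v x))) := by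
      simp only [hJ, Finset.sum_sub_distrib, Finset.sum_neg_distrib, Pi.zero_apply, sub_zero,
        add_zero]
      ring
    have e2 : ∑ x, ∑ y ∈ N x, a x y * (v y - v x) = 0 := by
      rw [sum_neighbors_mul_sub hN ha]; simp [hdiv]
    have e3 : dirichlet N v / 40 - α ^ 4 * (∑ x, ∑ y ∈ N x, a x y ^ 2) / 8 =
        ∑ x, ∑ y ∈ N x, (a x y * (v y - v x) + (v y - v x) ^ 2 / 40 -
          α ^ 4 * a x y ^ 2 / 8) := by
      simp only [Finset.sum_sub_distrib, Finset.sum_add_distrib, e2, dirichlet, Finset.sum_div,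
        Finset.mul_sum]
      ring
    rw [e1, e3]
    refine Finset.sum_le_sum fun x _ => Finset.sum_le_sum fun y hy => ?_
    have hax := haα x y hy
    have hD : |v y - v x| ≤ 1 / 10 := by
      refine abs_le_of_sq_le_sq ?_ (by norm_num)
      have := sq_sub_le_dirichlet v hy
      linarith
    have e4 := cos_sub_cos_add_lower (hax.trans hα) hD
    have e5 : a x y ^ 6 ≤ α ^ 4 * a x y ^ 2 := by
      have : |a x y| ^ 4 ≤ α ^ 4 := by gcongr
      have e6 : a x y ^ 6 = |a x y| ^ 4 * a x y ^ 2 := by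
        rw [← abs_pow, abs_of_nonneg (by positivity)]; ring
      rw [e6]
      gcongr
    linarith
  -- On the boundary of the ball, `J v ≤ J 0` would give `ρ/40 ≤ α⁴ ∑ a² / 8`, contrary to `hE`;
  -- hence the factor 5 there.
  have hlt : dirichlet N v < ρ := by
    refine lt_of_le_of_ne hvρ fun h => ?_
    have h1 : J v ≤ J 0 := hmin h0B
    rw [h] at hlow
    linarith
  have hcrit : ∀ φ : X → ℝ, φ x₀ = 0 →
      ∑ x, ∑ y ∈ N x, Real.sin (a x y + (v y - v x)) * (φ y - φ x) = 0 := by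
    intro φ hφ
    have hd : HasDerivAt (fun t : ℝ => J (v + t • φ))
        (∑ x, ∑ y ∈ N x, Real.sin (a x y + (v y - v x)) * (φ y - φ x)) 0 := by
      simp only [hJ, Pi.add_apply, Pi.smul_apply, smul_eq_mul]
      refine HasDerivAt.fun_sum fun x _ => HasDerivAt.fun_sum fun y _ => ?_
      have h1 : HasDerivAt (fun t : ℝ => a x y + (v y + t * φ y - (v x + t * φ x)))
          (1 * φ y - 1 * φ x) 0 :=
        ((((hasDerivAt_id' (0 : ℝ)).mul_const (φ y)).const_add (v y)).sub
          (((hasDerivAt_id' (0 : ℝ)).mul_const (φ x)).const_add (v x))).const_add (a x y)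
      refine h1.cos.neg.congr_deriv ?_
      simp
    refine IsLocalMin.hasDerivAt_eq_zero ?_ hd
    have hc : Continuous fun t : ℝ => dirichlet N (v + t • φ) :=
      (continuous_dirichlet N).comp (by fun_prop)
    have hev : ∀ᶠ t in nhds (0 : ℝ), dirichlet N (v + t • φ) < ρ :=
      hc.continuousAt.eventually_lt continuousAt_const (by simpa using hlt)
    filter_upwards [hev] with t ht
    have : J v ≤ J (v + t • φ) := hmin ⟨by simp [hv0, hφ], ht.le⟩
    simpa using this
  have hanti : ∀ x, ∀ y ∈ N x,
      Real.sin (a y x + (v x - v y)) = -Real.sin (a x y + (v y - v x)) := by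
    intro x y hy
    rw [ha x y hy, ← Real.sin_neg]
    congr 1
    ring
  refine ⟨v, hv0, hvρ, fun x => ?_⟩
  -- The indicator of `x` is shifted by a constant to vanish at `x₀`. Constants do not affect
  -- differences, so the equation also holds at `x₀`.
  have h2 := hcrit (fun z => (if z = x then 1 else 0) - if x₀ = x then 1 else 0) (by simp)
  simp only [sub_sub_sub_cancel_right] at h2
  rw [sum_neighbors_mul_sub hN (a := fun x y => Real.sin (a x y + (v y - v x))) hanti
    (fun z => if z = x then 1 else 0)] at h2
  simpa using h2

/-- Near a flow with small entries, the `ℓ²` distance to an equilibrium does not increase. -/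
theorem sum_sq_lt_of_sine_flow {N : X → Finset X} (hN : ∀ x y, y ∈ N x → x ∈ N y)
    {A : X → X → ℝ} (hA : ∀ x, ∀ y ∈ N x, A y x = -A x y)
    (hA' : ∀ x, ∀ y ∈ N x, |A x y| ≤ 1 / 2) (hst : ∀ x, ∑ y ∈ N x, Real.sin (A x y) = 0)
    {κ c : ℝ} (hκ : 0 ≤ κ) (hc : 0 ≤ c) {w : ℝ → X → ℝ}
    (hw : ∀ t, 0 ≤ t → ∀ x, HasDerivWithinAt (fun s => w s x)
      (κ * ∑ y ∈ N x, Real.sin (A x y + c * (w t y - w t x))) (Set.Ici 0) t)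
    {ρ : ℝ} (hρ : 0 < ρ) (hcρ : c * ρ ≤ 1 / 4) (h0 : ∑ x, w 0 x ^ 2 < ρ ^ 2) {t : ℝ}
    (ht : 0 ≤ t) : ∑ x, w t x ^ 2 < ρ ^ 2 := by
  set f : ℝ → ℝ := fun s => ∑ x, w s x ^ 2 with hf
  set f' : ℝ → ℝ := fun s => ∑ x, 2 * w s x *
    (κ * ∑ y ∈ N x, Real.sin (A x y + c * (w s y - w s x))) with hf'
  have hfd : ∀ s, 0 ≤ s → HasDerivWithinAt f (f' s) (Set.Ici 0) s := by
    intro s hs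
    refine HasDerivWithinAt.fun_sum fun x _ => ?_
    have := (hw s hs x).fun_pow 2
    simpa using this
  -- Subtracting the equilibrium equation and summing by parts yields `-κ ∑ b (w y - w x)`. Both
  -- arguments of sine in `b` stay within `[-1, 1]`, where sine increases, so each product is
  -- nonnegative.
  have hdecr : ∀ s, f s < ρ ^ 2 → f' s ≤ 0 := by
    intro s hs
    have hws : ∀ x, |w s x| ≤ ρ := fun x => by
      refine abs_le_of_sq_le_sq (le_trans ?_ hs.le) hρ.le
      exact Finset.single_le_sum (f := fun x => w s x ^ 2) (fun _ _ => sq_nonneg _)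
        (Finset.mem_univ x)
    set b : X → X → ℝ := fun x y => Real.sin (A x y + c * (w s y - w s x)) - Real.sin (A x y)
    have hb : ∀ x, ∀ y ∈ N x, b y x = -b x y := by
      intro x y hy
      simp only [b]
      rw [hA x y hy, Real.sin_neg,
        show -A x y + c * (w s x - w s y) = -(A x y + c * (w s y - w s x)) by ring, Real.sin_neg]
      ring
    have e1 : f' s = -κ * ∑ x, ∑ y ∈ N x, b x y * (w s y - w s x) := by
      rw [sum_neighbors_mul_sub hN hb]
      simp only [b, Finset.sum_sub_distrib, hst, sub_zero, hf']
      rw [Finset.mul_sum, Finset.mul_sum]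
      refine Finset.sum_congr rfl fun x _ => ?_
      ring
    rw [e1]
    refine mul_nonpos_of_nonpos_of_nonneg (by linarith) ?_
    refine Finset.sum_nonneg fun x _ => Finset.sum_nonneg fun y hy => ?_
    have hp := Real.pi_gt_three
    have h1 := abs_le.1 (hA' x y hy)
    have h2 : |c * (w s y - w s x)| ≤ 1 / 2 := by
      rw [abs_mul, abs_of_nonneg hc]
      have : |w s y - w s x| ≤ 2 * ρ := (abs_sub _ _).trans (by linarith [hws x, hws y])
      nlinarith
    have h3 := abs_le.1 h2
    have m1 : A x y ∈ Set.Icc (-(Real.pi / 2)) (Real.pi / 2) :=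
      ⟨by linarith, by linarith⟩
    have m2 : A x y + c * (w s y - w s x) ∈ Set.Icc (-(Real.pi / 2)) (Real.pi / 2) :=
      ⟨by linarith, by linarith⟩
    rcases le_total 0 (w s y - w s x) with h | h
    · refine mul_nonneg (sub_nonneg.2 ?_) h
      exact Real.strictMonoOn_sin.monotoneOn m1 m2 (by nlinarith)
    · refine mul_nonneg_of_nonpos_of_nonpos (sub_nonpos.2 ?_) h
      exact Real.strictMonoOn_sin.monotoneOn m2 m1 (by nlinarith)
  -- The comparison theorem needs a strict inequality of slopes, so the barrier `f 0 + η s` rises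
  -- slightly while staying below `ρ²` up to time `t`. The sign of `f'` is needed only where `f`
  -- meets the barrier, so no continuation argument is required.
  set η : ℝ := (ρ ^ 2 - f 0) / (2 * (t + 1)) with hη
  have hη0 : 0 < η := div_pos (sub_pos.2 h0) (by linarith)
  have hηt : η * (t + 1) = (ρ ^ 2 - f 0) / 2 := by rw [hη]; field_simp
  have hlt : ∀ s ≤ t, f 0 + η * s < ρ ^ 2 := by
    intro s hs
    have : f 0 < ρ ^ 2 := h0
    nlinarith
  have key := image_le_of_deriv_right_lt_deriv_boundary (f := f) (f' := f') (a := 0) (b := t)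
    (B := fun s => f 0 + η * s) (B' := fun _ => η)
    (fun s hs => ((hfd s hs.1).continuousWithinAt).mono fun r hr => hr.1)
    (fun s hs => (hfd s hs.1).mono (Set.Ici_subset_Ici.2 hs.1)) (by simp)
    (fun s => by simpa using ((hasDerivAt_id s).const_mul η).const_add (f 0))
    (fun s hs h => (hdecr s (h ▸ hlt s hs.2.le)).trans_lt hη0) ⟨ht, le_rfl⟩
  exact key.trans_lt (hlt t le_rfl)

end Network

/-! ### Graph energies on the gasket -/

/-- The renormalized energy at level `n`, summed over oriented edges. -/
noncomputable def energy (v : Plane → ℝ) (n : ℕ) : ℝ :=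
  (5 / 3) ^ n * ∑ w ∈ words n, ∑ i, ∑ j, (v (Fw w (corner j)) - v (Fw w (corner i))) ^ 2

/-- For given corner values the energy of the subdivided cell is least when each midpoint is 2/5,
2/5, 1/5 of the near, near and opposite corners, and equals 3/5 of the coarse energy. The squares
supplied are the deviations from this rule and their pairwise differences. -/
theorem cell_energy_le (h : Fin 3 → Fin 3 → ℝ) (hs : ∀ k i, h k i = h i k) :
    ∑ i, ∑ j, (h j j - h i i) ^ 2 ≤ 5 / 3 * ∑ k, ∑ i, ∑ j, (h k j - h k i) ^ 2 := by
  simp only [Fin.sum_univ_three, hs 1 0, hs 2 0, hs 2 1]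
  linarith [sq_nonneg (5 * h 0 1 - 2 * h 0 0 - 2 * h 1 1 - h 2 2),
    sq_nonneg (5 * h 0 2 - 2 * h 0 0 - 2 * h 2 2 - h 1 1),
    sq_nonneg (5 * h 1 2 - 2 * h 1 1 - 2 * h 2 2 - h 0 0),
    sq_nonneg (5 * (h 0 1 - h 0 2) - h 1 1 + h 2 2),
    sq_nonneg (5 * (h 0 1 - h 1 2) - h 0 0 + h 2 2),
    sq_nonneg (5 * (h 1 2 - h 0 2) - h 1 1 + h 0 0)]

theorem energy_le_succ (v : Plane → ℝ) (n : ℕ) : energy v n ≤ energy v (n + 1) := by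
  unfold energy
  rw [sum_words_succ, pow_succ, mul_assoc, Finset.mul_sum (a := (5 / 3 : ℝ))]
  refine mul_le_mul_of_nonneg_left (Finset.sum_le_sum fun w _ => ?_) (by positivity)
  have h := cell_energy_le (fun k i => v (Fw w (F k (corner i))))
    fun k i => by rw [F_corner_comm]
  simpa only [F_corner, Fw_append_singleton] using h

theorem energy_mono (v : Plane → ℝ) : Monotone (energy v) :=
  monotone_nat_of_le_succ (energy_le_succ v)

theorem energy_nonneg (v : Plane → ℝ) (n : ℕ) : 0 ≤ energy v n :=
  mul_nonneg (by positivity) (Finset.sum_nonneg fun _ _ => Finset.sum_nonneg fun _ _ =>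
    Finset.sum_nonneg fun _ _ => sq_nonneg _)

/-- One squared edge increment is at most `(3/5)^|w|` times the energy; `4/5` is a rational majorant
of the square root of `3/5`. -/
theorem abs_sub_le_energy (v : Plane → ℝ) {n : ℕ} (w : List (Fin 3)) (hw : w.length ≤ n)
    (i j : Fin 3) : |v (Fw w (corner j)) - v (Fw w (corner i))| ≤
      (4 / 5) ^ w.length * Real.sqrt (energy v n) := by
  set s : List (Fin 3) → ℝ :=
    fun w => ∑ i, ∑ j, (v (Fw w (corner j)) - v (Fw w (corner i))) ^ 2 with hs
  have h1 : (v (Fw w (corner j)) - v (Fw w (corner i))) ^ 2 ≤ s w := by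
    refine (Finset.single_le_sum
      (f := fun j => (v (Fw w (corner j)) - v (Fw w (corner i))) ^ 2)
      (fun _ _ => sq_nonneg _) (Finset.mem_univ j)).trans ?_
    exact Finset.single_le_sum
      (f := fun i => ∑ j, (v (Fw w (corner j)) - v (Fw w (corner i))) ^ 2)
      (fun _ _ => Finset.sum_nonneg fun _ _ => sq_nonneg _) (Finset.mem_univ i)
  have h2 : s w ≤ ∑ w' ∈ words w.length, s w' :=
    Finset.single_le_sum (f := s) (fun _ _ => Finset.sum_nonneg fun _ _ =>
      Finset.sum_nonneg fun _ _ => sq_nonneg _) (mem_words.2 rfl)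
  have h3 : ∑ w' ∈ words w.length, s w' = (3 / 5) ^ w.length * energy v w.length := by
    rw [energy, ← mul_assoc, ← mul_pow]; norm_num [hs]
  have h4 : (3 / 5 : ℝ) ^ w.length * energy v w.length ≤ (16 / 25) ^ w.length * energy v n := by
    exact mul_le_mul (pow_le_pow_left₀ (by norm_num) (by norm_num) _) (energy_mono v hw)
      (energy_nonneg v _) (by positivity)
  refine abs_le_of_sq_le_sq ?_ (by positivity)
  rw [mul_pow, Real.sq_sqrt (energy_nonneg v n), ← pow_mul, mul_comm w.length, pow_mul]
  norm_num
  linarith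

/-- Passing from `w` to `w ++ [k]` moves the base corner along an edge of the cell `w ++ [0]`. The
constant is the partial geometric sum of `(4/5)^j` from `j = 1`. -/
theorem abs_sub_corner_le (v : Plane → ℝ) {n : ℕ} (w : List (Fin 3)) (hw : w.length ≤ n) :
    |v (Fw w (corner 0)) - v (corner 0)| ≤
      4 * (1 - (4 / 5) ^ w.length) * Real.sqrt (energy v n) := by
  induction w using List.reverseRecOn with
  | nil => simp [Fw]
  | append_singleton w k ih =>
    have hl : (w ++ [k]).length = w.length + 1 := by simp
    have h1 := ih (by omega)
    have h2 := abs_sub_le_energy v (w ++ [0]) (by simpa using hw) 0 k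
    have e : (w ++ [(0 : Fin 3)]).length = w.length + 1 := by simp
    rw [e, Fw_append_singleton, Fw_append_singleton, F_corner, F_corner_comm] at h2
    rw [hl, Fw_append_singleton]
    have h3 := abs_add_le (v (Fw w (F k (corner 0))) - v (Fw w (corner 0)))
      (v (Fw w (corner 0)) - v (corner 0))
    rw [sub_add_sub_cancel] at h3
    rw [pow_succ] at h2 ⊢
    nlinarith

/-- Sobolev inequality on the vertices of level `n`. -/
theorem sq_le_energy (v : Plane → ℝ) {n : ℕ} (h0 : v (corner 0) = 0) {x : Plane}
    (hx : x ∈ V n) : v x ^ 2 ≤ 16 * energy v n := by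
  obtain ⟨w, rfl, i, rfl⟩ := mem_V_iff.1 hx
  have h1 := abs_sub_corner_le v w le_rfl
  have h2 := abs_sub_le_energy v w le_rfl 0 i
  have h3 := abs_add_le (v (Fw w (corner i)) - v (Fw w (corner 0)))
      (v (Fw w (corner 0)) - v (corner 0))
  rw [sub_add_sub_cancel, h0, sub_zero] at h3
  rw [h0] at h1
  have hs := Real.sqrt_nonneg (energy v w.length)
  have hp : (0 : ℝ) ≤ (4 / 5) ^ w.length := by positivity
  have h4 : |v (Fw w (corner i))| ≤ 4 * Real.sqrt (energy v w.length) := by nlinarith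
  have h5 := pow_le_pow_left₀ (abs_nonneg _) h4 2
  rw [sq_abs, mul_pow, Real.sq_sqrt (energy_nonneg v _)] at h5
  linarith

/-! ### Representatives of small circle elements -/

theorem coe_rep (θ : Circ) : (rep θ : Circ) = θ := AddCircle.coe_equivIoc

theorem abs_rep (θ : Circ) : |rep θ| = ‖θ‖ := by
  have h : rep θ ∈ Set.Ioc (-1 / 2 : ℝ) (-1 / 2 + 1) := (AddCircle.equivIoc (1 : ℝ) (-1 / 2) θ).2
  conv_rhs => rw [← coe_rep θ]
  refine ((AddCircle.norm_coe_eq_abs_iff (1 : ℝ) one_ne_zero).2 ?_).symm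
  rw [abs_one, abs_le]
  exact ⟨by linarith [h.1], by linarith [h.2]⟩

theorem rep_coe {s : ℝ} (h : |s| < 1 / 2) : rep (s : Circ) = s := by
  have h' := abs_lt.1 h
  exact AddCircle.equivIoc_coe_of_mem ⟨by linarith, by linarith⟩

theorem rep_zero : rep 0 = 0 := by
  simpa using rep_coe (s := 0) (by norm_num)

/-- The two representatives differ by less than 1/2, so no jump of `rep` is crossed. -/
theorem rep_sub {α β γ : Circ} (hα : ‖α - γ‖ < 1 / 4) (hβ : ‖β - γ‖ < 1 / 4) :
    rep (α - β) = rep (α - γ) - rep (β - γ) := by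
  rw [← abs_rep] at hα hβ
  have h : α - β = ((rep (α - γ) - rep (β - γ) : ℝ) : Circ) := by
    rw [AddCircle.coe_sub, coe_rep, coe_rep]; abel
  rw [h]
  exact rep_coe ((abs_sub _ _).trans_lt (by linarith))

theorem rep_neg {θ : Circ} (h : ‖θ‖ < 1 / 4) : rep (-θ) = -rep θ := by
  have := rep_sub (α := 0) (β := θ) (γ := 0) (by simp) (by simpa using h)
  simpa [rep_zero] using this

/-! ### Circle-valued harmonic functions are eventually graph harmonic -/

open Classical in
/-- The sum at the vertex `x` of quantities attached to the corners of the `m`-cells. -/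
noncomputable def vertexSum (σ : List (Fin 3) → Fin 3 → ℝ) (m : ℕ) (x : Plane) : ℝ :=
  ∑ w ∈ words m, ∑ i, if Fw w (corner i) = x then σ w i else 0

/-- In each cell an old vertex is never a midpoint, so it meets exactly one subcell, the one
carrying the same letter. -/
theorem vertexSum_succ_of_mem (σ : List (Fin 3) → Fin 3 → ℝ) {m : ℕ} {x : Plane}
    (hx : x ∈ V m) : vertexSum σ (m + 1) x = vertexSum (fun w i => σ (w ++ [i]) i) m x := by
  unfold vertexSum
  rw [sum_words_succ]
  refine Finset.sum_congr rfl fun w hw => Finset.sum_congr rfl fun k _ => ?_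
  rw [Finset.sum_eq_single k]
  · rw [Fw_append_singleton, F_corner]
  · intro i _ hik
    rw [if_neg]
    intro h
    rw [Fw_append_singleton] at h
    have hw' := mem_words.1 hw
    subst hw'
    exact hik (eq_of_midpoint_mem_V (h ▸ hx)).symm
  · simp

/-- A new vertex belongs to one parent cell and to exactly two of its subcells. -/
theorem vertexSum_succ_midpoint (σ : List (Fin 3) → Fin 3 → ℝ) (w : List (Fin 3))
    {k i : Fin 3} (hki : k ≠ i) :
    vertexSum σ (w.length + 1) (Fw w (F k (corner i))) = σ (w ++ [k]) i + σ (w ++ [i]) k := by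
  unfold vertexSum
  rw [sum_words_succ, Finset.sum_eq_single w]
  · have h1 : ∀ k' i', (if Fw (w ++ [k']) (corner i') = Fw w (F k (corner i))
        then σ (w ++ [k']) i' else 0) =
        (if k' = k ∧ i' = i then σ (w ++ [k]) i else 0) +
          if k' = i ∧ i' = k then σ (w ++ [i]) k else 0 := by
      intro k' i'
      rw [Fw_append_singleton]
      by_cases hA : k' = k ∧ i' = i
      · obtain ⟨rfl, rfl⟩ := hA
        simp [hki]
      · by_cases hB : k' = i ∧ i' = k
        · obtain ⟨rfl, rfl⟩ := hB
          rw [if_pos (by rw [F_corner_comm])]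
          simp [hki.symm]
        · rw [if_neg, if_neg hA, if_neg hB, add_zero]
          intro h
          rcases (eq_of_midpoint_eq rfl hki h.symm).2 with h' | h'
          · exact hA ⟨h'.1.symm, h'.2.symm⟩
          · exact hB ⟨h'.2.symm, h'.1.symm⟩
    simp only [h1, Finset.sum_add_distrib, ite_and, Finset.sum_ite_eq', Finset.mem_univ, if_true,
      Finset.sum_ite_irrel, Finset.sum_const_zero]
  · intro w' hw' hne
    refine Finset.sum_eq_zero fun k' _ => Finset.sum_eq_zero fun i' _ => ?_
    rw [if_neg]
    intro h
    rw [Fw_append_singleton] at h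
    exact hne (eq_of_midpoint_eq (mem_words.1 hw').symm hki h.symm).1.symm
  · intro h
    exact absurd (mem_words.2 rfl) h

theorem mem_V_succ_cases {m : ℕ} {x : Plane} (hx : x ∈ V (m + 1)) :
    x ∈ V m ∨ ∃ w : List (Fin 3), w.length = m ∧ ∃ k i, k ≠ i ∧ Fw w (F k (corner i)) = x := by
  obtain ⟨w, hw, i, rfl⟩ := mem_V_iff.1 hx
  induction w using List.reverseRecOn with
  | nil => simp at hw
  | append_singleton w k _ =>
    have hw' : w.length = m := by simpa using hw
    subst hw'
    rw [Fw_append_singleton]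
    by_cases hki : k = i
    · subst hki
      rw [F_corner]
      exact Or.inl (Fw_corner_mem_V w k)
    · exact Or.inr ⟨w, rfl, k, i, hki, rfl⟩

/-- A vertex belongs to at most two cells of each level. -/
theorem vertexSum_one_le {m : ℕ} {x : Plane} (hx : x ∈ V m) :
    vertexSum (fun _ _ => 1) m x ≤ 2 := by
  induction m with
  | zero =>
    obtain ⟨l, -, rfl⟩ := Finset.mem_image.1 hx
    have : words 0 = {[]} := by ext w; simp [mem_words]
    simp only [vertexSum, this, Fw, Finset.sum_singleton, id, corner_injective.eq_iff,
      Finset.sum_ite_eq', Finset.mem_univ, if_true]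
    norm_num
  | succ m ih =>
    rcases mem_V_succ_cases hx with h | ⟨w, rfl, k, i, hki, rfl⟩
    · rw [vertexSum_succ_of_mem _ h]
      exact ih h
    · rw [vertexSum_succ_midpoint _ w hki]
      norm_num

theorem abs_vertexSum_le {σ : List (Fin 3) → Fin 3 → ℝ} {m : ℕ} {x : Plane} (hx : x ∈ V m)
    {A : ℝ} (hA : 0 ≤ A) (h : ∀ w ∈ words m, ∀ i, |σ w i| ≤ A) :
    |vertexSum σ m x| ≤ 2 * A := by
  have h1 : |vertexSum σ m x| ≤ A * vertexSum (fun _ _ => 1) m x := by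
    unfold vertexSum
    rw [Finset.mul_sum]
    refine (Finset.abs_sum_le_sum_abs _ _).trans (Finset.sum_le_sum fun w hw => ?_)
    rw [Finset.mul_sum]
    refine (Finset.abs_sum_le_sum_abs _ _).trans (Finset.sum_le_sum fun i _ => ?_)
    split_ifs
    · simpa using h w hw i
    · simp
  have h2 := vertexSum_one_le hx
  nlinarith

/-- The lifted increments of `U` at the `i`-th corner of the cell `w`. -/
noncomputable def cellLap (U : Plane → Circ) (w : List (Fin 3)) (i : Fin 3) : ℝ :=
  ∑ j, rep (U (Fw w (corner j)) - U (Fw w (corner i)))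

/-- `U` has small oscillation on the vertices of the subdivided cell `w`. -/
def SmallOn (U : Plane → Circ) (w : List (Fin 3)) : Prop :=
  ∀ k i l j, ‖U (Fw w (F k (corner i))) - U (Fw w (F l (corner j)))‖ < 1 / 4

/-- Taking representatives relative to one base vertex makes `rep` an exact difference, which
reduces identities on the cell to real linear algebra. The symmetry of `g` encodes the gluing at
midpoints. -/
theorem SmallOn.exists_lift {U : Plane → Circ} {w : List (Fin 3)} (h : SmallOn U w) :
    ∃ g : Fin 3 → Fin 3 → ℝ, (∀ k i, g k i = g i k) ∧ ∀ k i l j,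
      rep (U (Fw w (F k (corner i))) - U (Fw w (F l (corner j)))) = g k i - g l j :=
  ⟨fun k i => rep (U (Fw w (F k (corner i))) - U (Fw w (F 0 (corner 0)))),
    fun k i => by simp only [F_corner_comm k i],
    fun k i l j => rep_sub (h k i 0 0) (h l j 0 0)⟩

/-- The increments at a midpoint of the cell `w`. -/
noncomputable def midLap (U : Plane → Circ) (w : List (Fin 3)) (k i : Fin 3) : ℝ :=
  cellLap U (w ++ [k]) i + cellLap U (w ++ [i]) k

/-- This is the rule for harmonic extension in dual form: the two midpoints next to corner `i` have
weight 2/5, the opposite one 1/5. The `min` and `max` merely orient the pair. -/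
theorem SmallOn.cellLap_eq {U : Plane → Circ} {w : List (Fin 3)} (h : SmallOn U w) (i : Fin 3) :
    cellLap U w i = 5 / 3 * (cellLap U (w ++ [i]) i +
      ((midLap U w 0 1 + midLap U w 0 2 + midLap U w 1 2) +
        ∑ k, if k = i then 0 else midLap U w (min i k) (max i k)) / 5) := by
  obtain ⟨g, hg, hU⟩ := h.exists_lift
  have h1 : ∀ k i, cellLap U (w ++ [k]) i = ∑ j, (g k j - g k i) := fun k i => by
    simp only [cellLap, Fw_append_singleton, hU]
  have h2 : cellLap U w i = ∑ j, (g j j - g i i) := by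
    simp only [cellLap, ← hU, F_corner]
  simp only [midLap, h1, h2]
  fin_cases i <;> simp [Fin.sum_univ_three, hg 1 0, hg 2 0, hg 2 1] <;> ring

/-- Harmonicity at the midpoints makes the renormalized energy of a cell invariant. -/
theorem SmallOn.energy_eq {U : Plane → Circ} {w : List (Fin 3)} (h : SmallOn U w)
    (hm : ∀ k i, k ≠ i → midLap U w k i = 0) :
    5 / 3 * ∑ k, ∑ i, ∑ j,
        rep (U (Fw (w ++ [k]) (corner j)) - U (Fw (w ++ [k]) (corner i))) ^ 2 =
      ∑ i, ∑ j, rep (U (Fw w (corner j)) - U (Fw w (corner i))) ^ 2 := by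
  obtain ⟨g, hg, hU⟩ := h.exists_lift
  have h1 : ∀ k i, cellLap U (w ++ [k]) i = ∑ j, (g k j - g k i) := fun k i => by
    simp only [cellLap, Fw_append_singleton, hU]
  have h2 : ∀ i j, rep (U (Fw w (corner j)) - U (Fw w (corner i))) = g j j - g i i := by
    intro i j
    simp only [← hU, F_corner]
  have m01 := hm 0 1 (by decide)
  have m02 := hm 0 2 (by decide)
  have m12 := hm 1 2 (by decide)
  simp only [midLap, h1, Fin.sum_univ_three, hg 1 0, hg 2 0, hg 2 1] at m01 m02 m12
  have p01 : g 0 1 = (2 * g 0 0 + 2 * g 1 1 + g 2 2) / 5 := by linarith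
  have p02 : g 0 2 = (2 * g 0 0 + 2 * g 2 2 + g 1 1) / 5 := by linarith
  have p12 : g 1 2 = (2 * g 1 1 + 2 * g 2 2 + g 0 0) / 5 := by linarith
  simp only [Fw_append_singleton, hU, h2, Fin.sum_univ_three, hg 1 0, hg 2 0, hg 2 1, p01, p02,
    p12]
  ring

theorem midLap_eq_vertexSum (U : Plane → Circ) (w : List (Fin 3)) {k i : Fin 3} (hki : k ≠ i) :
    midLap U w k i = vertexSum (cellLap U) (w.length + 1) (Fw w (F k (corner i))) :=
  (vertexSum_succ_midpoint _ w hki).symm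

theorem midpoint_notMem_V_zero (w : List (Fin 3)) {k i : Fin 3} (hki : k ≠ i) :
    Fw w (F k (corner i)) ∉ V 0 :=
  fun h => hki (eq_of_midpoint_mem_V (V_mono (Nat.zero_le _) h))

/-- The midpoint weights add up to 1 and `x` lies in at most two cells, so the error is at most `5/3
· 2 A`. -/
theorem abs_vertexSum_sub_le {U : Plane → Circ} {m : ℕ}
    (hU : ∀ w ∈ words m, SmallOn U w) {x : Plane} (hx : x ∈ V m) {A : ℝ} (hA : 0 ≤ A)
    (h : ∀ z ∈ V (m + 1), z ∉ V 0 → |vertexSum (cellLap U) (m + 1) z| ≤ A) :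
    |vertexSum (cellLap U) m x - 5 / 3 * vertexSum (cellLap U) (m + 1) x| ≤ 10 / 3 * A := by
  set D : List (Fin 3) → Fin 3 → ℝ := fun w i =>
    ((midLap U w 0 1 + midLap U w 0 2 + midLap U w 1 2) +
        ∑ k, if k = i then 0 else midLap U w (min i k) (max i k)) / 5 with hD
  have hmid : ∀ w ∈ words m, ∀ k i, k ≠ i → |midLap U w k i| ≤ A := by
    intro w hw k i hki
    obtain rfl := mem_words.1 hw
    rw [midLap_eq_vertexSum U w hki]
    exact h _ (Fw_F_corner_mem_V w k i) (midpoint_notMem_V_zero w hki)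
  have hDA : ∀ w ∈ words m, ∀ i, |D w i| ≤ A := by
    intro w hw i
    have a01 := abs_le.1 (hmid w hw 0 1 (by decide))
    have a02 := abs_le.1 (hmid w hw 0 2 (by decide))
    have a12 := abs_le.1 (hmid w hw 1 2 (by decide))
    rw [abs_le]
    fin_cases i <;> simp [hD, Fin.sum_univ_three] <;> constructor <;> linarith
  have h1 : vertexSum (cellLap U) m x =
      5 / 3 * vertexSum (cellLap U) (m + 1) x + 5 / 3 * vertexSum D m x := by
    rw [vertexSum_succ_of_mem _ hx]
    unfold vertexSum
    rw [← mul_add, ← Finset.sum_add_distrib, Finset.mul_sum]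
    refine Finset.sum_congr rfl fun w hw => ?_
    rw [← Finset.sum_add_distrib, Finset.mul_sum]
    refine Finset.sum_congr rfl fun i _ => ?_
    split_ifs
    · exact (hU w hw).cellLap_eq i
    · simp
  have h2 := abs_vertexSum_le hx hA hDA
  rw [h1, add_sub_cancel_left, abs_mul, abs_of_pos (by norm_num : (0 : ℝ) < 5 / 3)]
  linarith

/-- A circle-valued function whose renormalized graph Laplacians and normal derivatives tend to
zero is graph harmonic on all fine levels, including at the corners. -/
theorem vertexSum_cellLap_eq_zero {U : Plane → Circ} {M : ℕ}
    (hU : ∀ w : List (Fin 3), M ≤ w.length → SmallOn U w)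
    (hlap : ∀ ε > 0, ∃ M' : ℕ, ∀ m ≥ M', ∀ x ∈ V m, x ∉ V 0 →
      5 ^ m * |vertexSum (cellLap U) m x| ≤ ε)
    (hneu : ∀ i, Filter.Tendsto
      (fun m : ℕ => (5 / 3 : ℝ) ^ m * vertexSum (cellLap U) m (corner i)) Filter.atTop (nhds 0))
    {m : ℕ} (hm : M ≤ m) {x : Plane} (hx : x ∈ V m) : vertexSum (cellLap U) m x = 0 := by
  have hint : ∀ m, M ≤ m → ∀ x ∈ V m, x ∉ V 0 → vertexSum (cellLap U) m x = 0 := by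
    -- Going one level coarser multiplies the bound by `5/3 + 10/3 = 5`, exactly what the weight
    -- `5^m` absorbs.
    have hstep : ∀ ε : ℝ, 0 ≤ ε → ∀ p m, M ≤ m →
        (∀ x ∈ V (m + p), x ∉ V 0 → 5 ^ (m + p) * |vertexSum (cellLap U) (m + p) x| ≤ ε) →
        ∀ x ∈ V m, x ∉ V 0 → 5 ^ m * |vertexSum (cellLap U) m x| ≤ ε := by
      intro ε hε p
      induction p with
      | zero => exact fun m _ h => h
      | succ p ih =>
        intro m hm h x hx hx0
        have h5 : (0 : ℝ) < 5 ^ (m + 1) := by positivity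
        have h1 : ∀ z ∈ V (m + 1), z ∉ V 0 →
            |vertexSum (cellLap U) (m + 1) z| ≤ ε / 5 ^ (m + 1) := by
          intro z hz hz0
          rw [le_div_iff₀' h5]
          exact ih (m + 1) (by omega) (by rwa [add_right_comm, add_assoc]) z hz hz0
        have h2 := abs_vertexSum_sub_le (fun w hw => hU w ((mem_words.1 hw).symm ▸ hm)) hx
          (by positivity) h1
        have h3 := h1 x (V_subset_succ m hx) hx0
        have h4 := abs_add_le
          (vertexSum (cellLap U) m x - 5 / 3 * vertexSum (cellLap U) (m + 1) x)
          (5 / 3 * vertexSum (cellLap U) (m + 1) x)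
        rw [sub_add_cancel, abs_mul, abs_of_pos (by norm_num : (0 : ℝ) < 5 / 3)] at h4
        have h6 : |vertexSum (cellLap U) m x| ≤ 5 * (ε / 5 ^ (m + 1)) := by linarith
        have h7 : 5 * (ε / 5 ^ (m + 1)) = ε / 5 ^ m := by rw [pow_succ]; field_simp
        rwa [h7, le_div_iff₀' (by positivity)] at h6
    intro m hm x hx hx0
    have h0 : 5 ^ m * |vertexSum (cellLap U) m x| ≤ 0 := by
      refine le_of_forall_pos_le_add fun ε hε => ?_
      obtain ⟨M', hM'⟩ := hlap ε hε
      rw [zero_add]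
      exact hstep ε hε.le M' m hm (hM' _ (by omega)) x hx hx0
    have h5 : (0 : ℝ) < 5 ^ m := by positivity
    exact abs_nonpos_iff.1 (by nlinarith)
  by_cases hx0 : x ∈ V 0
  · obtain ⟨i, -, rfl⟩ := Finset.mem_image.1 hx0
    set c : ℕ → ℝ := fun m => (5 / 3 : ℝ) ^ m * vertexSum (cellLap U) m (corner i) with hc
    -- With vanishing interior sums the renormalized corner sum no longer depends on the level, so
    -- it equals its limit 0.
    have h1 : ∀ m, M ≤ m → c (m + 1) = c m := by
      intro m hm
      have h2 := abs_vertexSum_sub_le (fun w hw => hU w ((mem_words.1 hw).symm ▸ hm))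
        (corner_mem_V i m) le_rfl
        (fun z hz hz0 => by rw [hint (m + 1) (by omega) z hz hz0, abs_zero])
      rw [mul_zero] at h2
      have h3 := sub_eq_zero.1 (abs_nonpos_iff.1 h2)
      simp only [hc]
      rw [h3, pow_succ]; ring
    have h2 : ∀ p, c (m + p) = c m := by
      intro p
      induction p with
      | zero => rfl
      | succ p ih => rw [← ih, ← add_assoc, h1 _ (by omega)]
    have h3 : Filter.Tendsto (fun p => c (p + m)) Filter.atTop (nhds 0) :=
      (Filter.tendsto_add_atTop_iff_nat m).2 (hneu i)
    have h4 : c m = 0 := by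
      refine tendsto_nhds_unique ?_ h3
      refine tendsto_const_nhds.congr fun p => ?_
      rw [add_comm p m, h2]
    exact (mul_eq_zero.1 h4).resolve_left (by positivity)
  · exact hint m hm x hx hx0

/-- The renormalized energy of a circle-valued function. -/
noncomputable def circEnergy (U : Plane → Circ) (n : ℕ) : ℝ :=
  (5 / 3) ^ n *
    ∑ w ∈ words n, ∑ i, ∑ j, rep (U (Fw w (corner j)) - U (Fw w (corner i))) ^ 2

theorem circEnergy_eq {U : Plane → Circ} {M : ℕ}
    (hU : ∀ w : List (Fin 3), M ≤ w.length → SmallOn U w)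
    (h0 : ∀ m, M ≤ m → ∀ x ∈ V m, vertexSum (cellLap U) m x = 0) {n : ℕ} (hn : M ≤ n) :
    circEnergy U n = circEnergy U M := by
  induction n, hn using Nat.le_induction with
  | base => rfl
  | succ n hn ih =>
    rw [← ih]
    unfold circEnergy
    rw [sum_words_succ, pow_succ, mul_assoc, Finset.mul_sum (a := (5 / 3 : ℝ))]
    congr 1
    refine Finset.sum_congr rfl fun w hw => ?_
    obtain rfl := mem_words.1 hw
    refine (hU w hn).energy_eq fun k i hki => ?_
    rw [midLap_eq_vertexSum U w hki]
    exact h0 _ (by omega) _ (Fw_F_corner_mem_V w k i)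

/-! ### Continuity of the loops and invariance of the degree -/

theorem continuous_perimeter : Continuous perimeter := by
  set P : ℝ → Plane := fun s =>
    if s ≤ 1 / 3 then AffineMap.lineMap (corner 0) (corner 1) (3 * s)
    else if s ≤ 2 / 3 then AffineMap.lineMap (corner 1) (corner 2) (3 * s - 1)
    else AffineMap.lineMap (corner 2) (corner 0) (3 * s - 2) with hP
  have hc : ∀ (i j : Fin 3) (c : ℝ), Continuous fun s : ℝ =>
      (AffineMap.lineMap (corner i) (corner j) (3 * s - c) : Plane) := fun i j c =>
    AffineMap.lineMap_continuous.comp (by fun_prop)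
  have hPc : Continuous P := by
    refine Continuous.if_le (by simpa using hc 0 1 0)
      (Continuous.if_le (hc 1 2 1) (hc 2 0 2) continuous_id continuous_const ?_)
      continuous_id continuous_const ?_
    · rintro s rfl; norm_num
    · rintro s rfl; norm_num
  exact hPc.continuousOn.comp_fract'' (by norm_num [hP])

theorem continuous_loop (w : List (Fin 3)) : Continuous (loop w) := by
  have h : Continuous (Fw w) := by
    induction w with
    | nil => exact continuous_id
    | cons i w ih => exact (continuous_F i).comp ih
  exact (h.comp continuous_perimeter).subtype_mk _

theorem loop_one (w : List (Fin 3)) : loop w 1 = loop w 0 := by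
  simp [loop, perimeter]

theorem norm_coe_le_abs (s : ℝ) : ‖(s : Circ)‖ ≤ |s| :=
  QuotientAddGroup.norm_mk_le_norm

/-- Adding a real-valued function does not change the degree. -/
theorem HasDegree.add_real {u ut : C(gasket, Circ)} {ω : List (Fin 3) →₀ ℤ} (hu : HasDegree u ω)
    {p : gasket → ℝ} (hp : Continuous p) (h : ∀ x, ut x = u x + (p x : Circ)) :
    HasDegree ut ω := by
  intro w
  obtain ⟨g, ⟨hg, hl⟩, hd⟩ := hu w
  refine ⟨fun t => g t + p (loop w t), ⟨hg.add (hp.comp (continuous_loop w)), fun t => ?_⟩, ?_⟩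
  · rw [AddCircle.coe_add, hl, h]
  · simp only [loop_one, ← hd]; ring

/-- Tietze extension from the finite, hence closed and discrete, vertex set, keeping the bound. -/
theorem exists_real_extension {n : ℕ} (v : V n → ℝ) {c : ℝ} (hc : 0 ≤ c) (hv : ∀ x, |v x| ≤ c) :
    ∃ p : gasket → ℝ, Continuous p ∧ (∀ x, |p x| ≤ c) ∧ ∀ x : V n, p (incl x) = v x := by
  have he : Topology.IsClosedEmbedding (incl : V n → gasket) := by
    refine continuous_of_discreteTopology.isClosedEmbedding fun x y h => Subtype.ext ?_
    exact congrArg (fun z : gasket => (z : Plane)) h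
  obtain ⟨g, hg, hgv⟩ := BoundedContinuousFunction.exists_extension_forall_mem_Icc_of_isClosedEmbedding
    (BoundedContinuousFunction.mkOfCompact ⟨v, continuous_of_discreteTopology⟩)
    (a := -c) (b := c) (fun x => abs_le.1 (hv x)) (by linarith) he
  exact ⟨g, g.continuous, fun x => abs_le.2 (hg x), fun x => congrFun hgv x⟩

/-! ### The discretized harmonic map -/

open Classical in
/-- The extension of `u` by zero to the plane. -/
noncomputable def circExt (u : C(gasket, Circ)) (x : Plane) : Circ :=
  if h : x ∈ gasket then u ⟨x, h⟩ else 0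

theorem circExt_incl (u : C(gasket, Circ)) {n : ℕ} (x : V n) : circExt u x = u (incl x) :=
  dif_pos (V_subset_gasket n x.2)

theorem circExt_of_mem (u : C(gasket, Circ)) {x : Plane} (h : x ∈ gasket) :
    circExt u x = u ⟨x, h⟩ :=
  dif_pos h

theorem exists_small_oscillation (u : C(gasket, Circ)) {η : ℝ} (hη : 0 < η) :
    ∃ M : ℕ, ∀ w : List (Fin 3), M ≤ w.length → ∀ x ∈ gasket, ∀ y ∈ gasket,
      ‖circExt u (Fw w x) - circExt u (Fw w y)‖ < η := by
  have : CompactSpace gasket := isCompact_iff_compactSpace.1 gasket_isCompact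
  obtain ⟨δ, hδ, h⟩ := Metric.uniformContinuous_iff.1
    (CompactSpace.uniformContinuous_of_continuous u.continuous) η hη
  obtain ⟨C, hC⟩ := Metric.isBounded_iff.1 gasket_isCompact.isBounded
  have ht : Filter.Tendsto (fun n : ℕ => (2⁻¹ : ℝ) ^ n * C) Filter.atTop (nhds 0) := by
    simpa using (tendsto_pow_atTop_nhds_zero_of_lt_one (r := (2⁻¹ : ℝ)) (by norm_num)
      (by norm_num)).mul_const C
  obtain ⟨M, hM⟩ := Filter.eventually_atTop.1 (ht.eventually_lt_const hδ)
  refine ⟨M, fun w hw x hx y hy => ?_⟩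
  rw [circExt_of_mem u (Fw_mem_gasket w hx), circExt_of_mem u (Fw_mem_gasket w hy),
    ← dist_eq_norm]
  refine h ?_
  rw [Subtype.dist_eq, dist_Fw]
  exact (mul_le_mul_of_nonneg_left (hC hx hy) (by positivity)).trans_lt (hM _ hw)

theorem corner_mem_gasket (i : Fin 3) : corner i ∈ gasket :=
  V_subset_gasket 0 (corner_mem_V i 0)

theorem smallOn_of_oscillation {U : Plane → Circ} {w : List (Fin 3)}
    (h : ∀ x ∈ gasket, ∀ y ∈ gasket, ‖U (Fw w x) - U (Fw w y)‖ < 1 / 4) : SmallOn U w :=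
  fun k i l j => h _ (F_mem_gasket k (corner_mem_gasket i)) _
    (F_mem_gasket l (corner_mem_gasket j))

theorem sum_rep_eq_vertexSum (U : Plane → Circ) {n : ℕ} (x : V n) :
    (open Classical in ∑ y ∈ (graph n).neighborFinset x, rep (U y - U x)) =
      vertexSum (cellLap U) n x := by
  classical
  have := sum_neighborFinset x (fun y => rep (U y - U x)) (by simp [rep_zero])
  refine Eq.trans ?_ (this.trans ?_)
  · convert rfl
  · unfold vertexSum cellLap
    refine Finset.sum_congr rfl fun w _ => Finset.sum_congr rfl fun i _ => ?_
    split_ifs with h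
    · rw [h]
    · rfl

theorem increments_eq_vertexSum (u : C(gasket, Circ)) {m : ℕ} (x : V m) :
    increments u m x = vertexSum (cellLap (circExt u)) m x := by
  rw [← sum_rep_eq_vertexSum]
  unfold increments
  simp only [circExt_incl]

/-- A harmonic map restricts to exactly graph harmonic maps on all fine levels. -/
theorem IsHarmonicMap.exists_graph_harmonic {u : C(gasket, Circ)} {ω : List (Fin 3) →₀ ℤ}
    (hu : IsHarmonicMap u ω) : ∃ M : ℕ, ∃ E : ℝ, 0 ≤ E ∧ ∀ n ≥ M,
      (∀ x ∈ V n, vertexSum (cellLap (circExt u)) n x = 0) ∧ circEnergy (circExt u) n = E := by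
  obtain ⟨M, hM⟩ := exists_small_oscillation u (η := 1 / 4) (by norm_num)
  have hU : ∀ w : List (Fin 3), M ≤ w.length → SmallOn (circExt u) w :=
    fun w hw => smallOn_of_oscillation (hM w hw)
  have h0 : ∀ m, M ≤ m → ∀ x ∈ V m, vertexSum (cellLap (circExt u)) m x = 0 := by
    intro m hm x hx
    refine vertexSum_cellLap_eq_zero hU ?_ ?_ hm hx
    · intro ε hε
      obtain ⟨M', hM'⟩ := hu.laplacian ε hε
      refine ⟨M', fun m hm x hx hx0 => ?_⟩
      have h := hM' m hm ⟨x, hx⟩ hx0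
      rw [increments_eq_vertexSum, ContinuousMap.zero_apply, sub_zero, abs_mul,
        abs_of_pos (by positivity : (0 : ℝ) < 3 / 2 * 5 ^ m)] at h
      have h5 : (0 : ℝ) ≤ 5 ^ m * |vertexSum (cellLap (circExt u)) m x| := by positivity
      dsimp only at h
      nlinarith
    · intro i
      have h := hu.neumann i
      unfold HasNormalDeriv at h
      simp only [increments_eq_vertexSum] at h
      exact h
  refine ⟨M, circEnergy (circExt u) M, ?_, fun n hn => ⟨h0 n hn, circEnergy_eq hU h0 hn⟩⟩
  unfold circEnergy
  positivity

/-! ### Stability and existence -/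

open Classical in
/-- A steady state all of whose phase differences are small is stable. -/
theorem isStable_of_small {n : ℕ} {un : V n → Circ} {A : V n → V n → ℝ}
    (hA : ∀ x, ∀ y ∈ (graph n).neighborFinset x, A y x = -A x y)
    (hA' : ∀ x, ∀ y ∈ (graph n).neighborFinset x, |A x y| ≤ 1 / 2)
    (hst : ∀ x, ∑ y ∈ (graph n).neighborFinset x, Real.sin (A x y) = 0)
    (hun : ∀ x, ∀ y ∈ (graph n).neighborFinset x,
      un y - un x = ((A x y / (2 * Real.pi) : ℝ) : Circ)) : IsStable n un := by
  intro ε hε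
  have hpi := Real.pi_pos
  -- The second bound gives `2π ρ ≤ 1/4`, as the flow estimate requires. Starting within `ρ/(k + 1)`
  -- at each of `k` vertices keeps the initial `ℓ²` norm below `ρ`.
  set ρ : ℝ := min ε (1 / (8 * Real.pi)) with hρ
  have hρ0 : 0 < ρ := lt_min hε (by positivity)
  set k : ℝ := (Fintype.card (V n) : ℝ) with hk
  have hk0 : 0 ≤ k := Nat.cast_nonneg _
  refine ⟨ρ / (k + 1), by positivity, fun U hU h0 t ht x => ?_⟩
  obtain ⟨φ, hφ⟩ := hU
  -- The lift of `un` closest to the initial lift of the solution, so that small circle distance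
  -- becomes small real distance.
  set ψ : V n → ℝ := fun x => φ 0 x - rep (U 0 x - un x)
  have hψ : ∀ x, (ψ x : Circ) = un x := fun x => by
    simp only [ψ]
    rw [AddCircle.coe_sub, coe_rep, (hφ 0 le_rfl x).1]; abel
  have key := sum_sq_lt_of_sine_flow (N := fun x => (graph n).neighborFinset x)
    (fun x y h => by
      rw [SimpleGraph.mem_neighborFinset] at h ⊢; exact h.symm) hA hA' hst
    (κ := (5 / 3) ^ n) (c := 2 * Real.pi) (by positivity) (by positivity)
    (w := fun t x => φ t x - ψ x) (fun t ht x => ?_) hρ0 ?_ ?_ ht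
  · have h1 : (φ t x - ψ x) ^ 2 < ρ ^ 2 :=
      (Finset.single_le_sum (f := fun x => (φ t x - ψ x) ^ 2) (fun _ _ => sq_nonneg _)
        (Finset.mem_univ x)).trans_lt key
    have h2 : |φ t x - ψ x| < ρ := abs_lt_of_sq_lt_sq h1 hρ0.le
    have h3 : U t x - un x = ((φ t x - ψ x : ℝ) : Circ) := by
      rw [AddCircle.coe_sub, (hφ t ht x).1, hψ]
    rw [h3]
    exact (norm_coe_le_abs _).trans_lt (h2.trans_le (min_le_left _ _))
  · refine ((hφ t ht x).2.sub_const (ψ x)).congr_deriv ?_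
    unfold kuramotoField
    congr 1
    refine Finset.sum_congr rfl fun y hy => ?_
    have h3 : U t y - U t x =
        ((A x y / (2 * Real.pi) + ((φ t y - ψ y) - (φ t x - ψ x)) : ℝ) : Circ) := by
      rw [AddCircle.coe_add, ← hun x y hy, ← hψ, ← hψ, ← (hφ t ht y).1, ← (hφ t ht x).1,
        ← AddCircle.coe_sub, ← AddCircle.coe_sub, ← AddCircle.coe_add]
      congr 1
      ring
    rw [h3, sinCirc_coe]
    congr 1
    field_simp
  · have : ρ ≤ 1 / (8 * Real.pi) := min_le_right _ _
    calc 2 * Real.pi * ρ ≤ 2 * Real.pi * (1 / (8 * Real.pi)) := by gcongr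
      _ = 1 / 4 := by field_simp; norm_num
  · have h1 : ∀ x : V n, (φ 0 x - ψ x) ^ 2 ≤ (ρ / (k + 1)) ^ 2 := fun x => by
      simp only [ψ, sub_sub_cancel]
      refine sq_le_sq' ?_ ?_ <;> have := abs_lt.1 ((abs_rep _).trans_lt (h0 x)) <;> linarith
    refine (Finset.sum_le_sum fun x _ => h1 x).trans_lt ?_
    rw [Finset.sum_const, nsmul_eq_mul, Finset.card_univ, ← hk, div_pow, mul_div_assoc',
      div_lt_iff₀ (by positivity), mul_comm]
    exact mul_lt_mul_of_pos_left (by nlinarith) (by positivity)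

open Classical in
/-- The level-`n` energy of a function on the vertices controls its values. -/
theorem sq_le_dirichlet {n : ℕ} (v : V n → ℝ) (h0 : v (cornerV n 0) = 0) (x : V n) :
    v x ^ 2 ≤ 16 * (5 / 3) ^ n * dirichlet (fun x => (graph n).neighborFinset x) v := by
  set w : Plane → ℝ := fun x => if h : x ∈ V n then v ⟨x, h⟩ else 0 with hw
  have hwv : ∀ x : V n, w x = v x := fun x => dif_pos x.2
  have h1 := sq_le_energy w (n := n) ((hwv (cornerV n 0)).trans h0) x.2
  have h2 := sum_edges n (fun x y => (w y - w x) ^ 2) (by simp)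
  simp only [hwv] at h1 h2
  rw [energy, ← h2] at h1
  rw [mul_assoc]
  exact h1

/-- Near a harmonic map of degree `ω`, the Kuramoto model on every fine graph has a stable steady
state with a continuous extension of the same degree. -/
theorem IsHarmonicMap.exists_stable_steadyState {ω : List (Fin 3) →₀ ℤ} {u : C(gasket, Circ)}
    (hu : IsHarmonicMap u ω) {ε : ℝ} (hε : 0 < ε) :
    ∃ N : ℕ, ∀ n ≥ N, ∃ un : V n → Circ,
      IsSteadyState n un ∧ IsStable n un ∧ un (cornerV n 0) = 0 ∧
      (∀ x : V n, ‖un x - u (incl x)‖ < ε) ∧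
      ∃ ut : C(gasket, Circ), (∀ x : V n, ut (incl x) = un x) ∧ HasDegree ut ω ∧
        ∀ x : gasket, ‖ut x - u x‖ < ε := by
  classical
  obtain ⟨M₁, E, hE, hM₁⟩ := hu.exists_graph_harmonic
  have hpi := Real.pi_gt_three
  obtain ⟨r, hr0, hr1, hrε⟩ : ∃ r : ℝ, 0 < r ∧ r ≤ 1 / 100 ∧ 16 * r ≤ ε ^ 2 :=
    ⟨min (1 / 100) (ε ^ 2 / 16), by positivity, min_le_left _ _, by
      linarith [min_le_right (1 / 100 : ℝ) (ε ^ 2 / 16)]⟩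
  obtain ⟨α, hα0, hα1, hαE⟩ :
      ∃ α : ℝ, 0 < α ∧ α ≤ 1 / 10 ∧ 5 * α ^ 4 * ((2 * Real.pi) ^ 2 * E) < r := by
    set c : ℝ := 5 * ((2 * Real.pi) ^ 2 * E) with hc
    have hc0 : 0 ≤ c := by positivity
    refine ⟨min (1 / 10) (r / (c + 1)), by positivity, min_le_left _ _, ?_⟩
    set α : ℝ := min (1 / 10) (r / (c + 1))
    have h0 : 0 < α := by positivity
    have h1 : α ≤ 1 / 10 := min_le_left _ _
    have h2 : α * (c + 1) ≤ r := by
      rw [← le_div_iff₀ (by positivity)]; exact min_le_right _ _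
    have h3 : α ^ 4 ≤ α := pow_le_of_le_one h0.le (by linarith) (by norm_num)
    calc 5 * α ^ 4 * ((2 * Real.pi) ^ 2 * E) = α ^ 4 * c := by rw [hc]; ring
      _ ≤ α * c := by gcongr
      _ < r := by linarith
  -- `α` was fixed from `E` and `r` alone, so the level from which the flow is this small can be
  -- chosen now.
  obtain ⟨M₂, hM₂⟩ := exists_small_oscillation u (η := α / (2 * Real.pi)) (by positivity)
  refine ⟨max M₁ M₂, fun n hn => ?_⟩
  obtain ⟨hharm, hen⟩ := hM₁ n ((le_max_left _ _).trans hn)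
  set U : Plane → Circ := circExt u with hU
  set N : V n → Finset (V n) := fun x => (graph n).neighborFinset x with hN
  have hNs : ∀ x y, y ∈ N x → x ∈ N y := fun x y h => by
    simp only [hN, SimpleGraph.mem_neighborFinset] at h ⊢; exact h.symm
  have hosc : ∀ x, ∀ y ∈ N x, ‖U y - U x‖ < α / (2 * Real.pi) := by
    intro x y hy
    simp only [hN, SimpleGraph.mem_neighborFinset] at hy
    obtain ⟨-, w, rfl, ⟨p, hp, hpx⟩, ⟨q, hq, hqy⟩⟩ := hy
    rw [← hpx, ← hqy]
    exact hM₂ w ((le_max_right _ _).trans hn) _ (V_subset_gasket 0 hq) _ (V_subset_gasket 0 hp)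
  have hquarter : α / (2 * Real.pi) < 1 / 4 := by
    rw [div_lt_iff₀ (by positivity)]; linarith
  set a : V n → V n → ℝ := fun x y => 2 * Real.pi * rep (U y - U x) with ha
  have haa : ∀ x, ∀ y ∈ N x, a y x = -a x y := by
    intro x y hy
    simp only [ha]
    rw [← neg_sub (U y) (U x), rep_neg ((hosc x y hy).trans hquarter)]
    ring
  have haα : ∀ x, ∀ y ∈ N x, |a x y| ≤ α := by
    intro x y hy
    simp only [ha]
    rw [abs_mul, abs_rep, abs_of_pos (by positivity : 0 < 2 * Real.pi)]
    have := (hosc x y hy).le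
    rwa [le_div_iff₀' (by positivity)] at this
  have hdiv : ∀ x, ∑ y ∈ N x, a x y = 0 := by
    intro x
    simp only [ha]
    rw [← Finset.mul_sum]
    have h := (sum_rep_eq_vertexSum U x).trans (hharm x x.2)
    have h' : ∑ y ∈ N x, rep (U y - U x) = 0 := by
      rw [← h]
    rw [h', mul_zero]
  have h35 : (0 : ℝ) < (3 / 5) ^ n := by positivity
  have h53 : (5 / 3 : ℝ) ^ n * (3 / 5) ^ n = 1 := by rw [← mul_pow]; norm_num
  have hEa : ∑ x, ∑ y ∈ N x, a x y ^ 2 = (3 / 5) ^ n * ((2 * Real.pi) ^ 2 * E) := by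
    have h1 := sum_edges n (fun x y => rep (U y - U x) ^ 2) (by simp [rep_zero])
    have h2 : ∑ x, ∑ y ∈ N x, a x y ^ 2 =
        (2 * Real.pi) ^ 2 * ∑ x : V n, ∑ y ∈ N x, rep (U y - U x) ^ 2 := by
      simp only [ha, mul_pow, Finset.mul_sum]
    rw [h2, h1, ← hen, circEnergy]
    linear_combination (-(2 * Real.pi) ^ 2 * ∑ w ∈ words n, ∑ i, ∑ j,
      rep (U (Fw w (corner j)) - U (Fw w (corner i))) ^ 2) * h53
  -- The radius scales like the energy of `a`, so the smallness condition reduces to `hαE`, free of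
  -- `n`; the factor `(5/3)^n` in the Sobolev constant later cancels it.
  obtain ⟨v, hv0, hvρ, hveq⟩ := exists_sine_equilibrium hNs haa hdiv haα hα1
    (ρ := (3 / 5) ^ n * r) (K := 16 * (5 / 3) ^ n) (by positivity)
    (by nlinarith [pow_le_one₀ (n := n) (by norm_num : (0 : ℝ) ≤ 3 / 5) (by norm_num)])
    (by positivity) (cornerV n 0) (fun v h0 x => sq_le_dirichlet v h0 x)
    (by rw [hEa]; nlinarith)
  have hvε : ∀ x, |v x / (2 * Real.pi)| ≤ ε / 2 := by
    intro x
    have h1 := sq_le_dirichlet v hv0 x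
    have h2 : 16 * (5 / 3) ^ n * dirichlet N v ≤ 16 * r := by
      calc 16 * (5 / 3) ^ n * dirichlet N v ≤ 16 * (5 / 3) ^ n * ((3 / 5) ^ n * r) := by gcongr
        _ = 16 * r := by linear_combination 16 * r * h53
    have h3 : |v x| ≤ ε := abs_le_of_sq_le_sq (h1.trans (h2.trans hrε)) hε.le
    rw [abs_div, abs_of_pos (by positivity : 0 < 2 * Real.pi), div_le_iff₀ (by positivity)]
    nlinarith
  have hdiff : ∀ x y : V n, (u (incl y) + ((v y / (2 * Real.pi) : ℝ) : Circ)) -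
      (u (incl x) + ((v x / (2 * Real.pi) : ℝ) : Circ)) =
      (((a x y + (v y - v x)) / (2 * Real.pi) : ℝ) : Circ) := by
    intro x y
    have h : (a x y + (v y - v x)) / (2 * Real.pi) =
        rep (U y - U x) + (v y / (2 * Real.pi) - v x / (2 * Real.pi)) := by
      simp only [ha]; field_simp
    rw [h, AddCircle.coe_add, AddCircle.coe_sub, coe_rep, hU, circExt_incl, circExt_incl]
    abel
  obtain ⟨p, hpc, hpε, hpv⟩ := exists_real_extension (fun x => v x / (2 * Real.pi))
    (by positivity) hvε
  refine ⟨fun x => u (incl x) + ((v x / (2 * Real.pi) : ℝ) : Circ), ?_, ?_, ?_, ?_,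
    ⟨⟨fun x => u x + (p x : Circ),
      u.continuous.add ((AddCircle.continuous_mk' (1 : ℝ)).comp hpc)⟩, ?_, ?_, ?_⟩⟩
  · intro x
    unfold kuramotoField
    refine mul_eq_zero_of_right _ ?_
    rw [← hveq x]
    refine Finset.sum_congr rfl fun y _ => ?_
    rw [hdiff, sinCirc_coe]
    congr 1
    field_simp
  · refine isStable_of_small (A := fun x y => a x y + (v y - v x)) ?_ ?_ hveq
      fun x y _ => hdiff x y
    · intro x y hy
      rw [haa x y hy]; ring
    · intro x y hy
      have h1 : |v y - v x| ≤ 1 / 10 := by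
        refine abs_le_of_sq_le_sq ?_ (by norm_num)
        refine (sq_sub_le_dirichlet (N := N) v hy).trans (hvρ.trans ?_)
        nlinarith [pow_le_one₀ (n := n) (by norm_num : (0 : ℝ) ≤ 3 / 5) (by norm_num)]
      exact (abs_add_le _ _).trans (by linarith [haα x y hy])
  · have h := hu.base
    simp only [hv0, zero_div, AddCircle.coe_zero, add_zero]
    exact h
  · intro x
    rw [add_sub_cancel_left]
    exact (norm_coe_le_abs _).trans_lt ((hvε x).trans_lt (by linarith))
  · intro x
    simp [hpv]
  · exact hu.degree.add_real hpc fun x => rfl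
  · intro x
    simp only [ContinuousMap.coe_mk, add_sub_cancel_left]
    exact (norm_coe_le_abs _).trans_lt ((hpε x).trans_lt (by linarith))

end SG

theorem mainTheorem1 (ω : List (Fin 3) →₀ ℤ) (u : C(SG.gasket, SG.Circ))
    (hu : SG.IsHarmonicMap u ω) (ε : ℝ) (hε : 0 < ε) :
    ∃ N : ℕ, ∀ n ≥ N, ∃ un : SG.V n → SG.Circ,
      SG.IsSteadyState n un ∧ SG.IsStable n un ∧ un (SG.cornerV n 0) = 0 ∧
      (∀ x : SG.V n, ‖un x - u (SG.incl x)‖ < ε) ∧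
      ∃ ut : C(SG.gasket, SG.Circ),
        (∀ x : SG.V n, ut (SG.incl x) = un x) ∧
        SG.HasDegree ut ω ∧
        ∀ x : SG.gasket, ‖ut x - u x‖ < ε := by
  exact hu.exists_stable_steadyState hε
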